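/- **Setting.** For $i\in\{1,\dots,N\}$ ($N\ge1$) let $\mathcal M^i=(\mathcal S^i,\mathcal A^i,H,s_0^i,p^i,r^i)$ be an episodic MDP with finite state and action spaces of cardinalities $S_i,A_i$, common horizon $H\ge1$, transition model $p^i$ and deterministic reward $r^i_h(s,a)\in[0,1]$. Policies are deterministic and may depend on the whole history of states and actions. For $U:[0,H]\to[0,H]$ let $J^\pi(U;p,r)=\mathbb E_{p,r,\pi}[U(\sum_{h=1}^H r_h(s_h,a_h))]$, $J^*(U;p,r)=\max_\pi J^\pi(U;p,r)$, and $\overline{\mathcal C}_i(U)=J^*(U;p^i,r^i)-J^{\pi^{E,i}}(U;p^i,r^i)$ for given expert policies $\pi^{E,i}$. Let $\underline{\mathfrak U}$ be the set of continuous (weakly) increasing $U:[0,H]\to[0,H]$ with $U(0)=0$, $U(H)=H$; let $\underline{\mathfrak U}_L$ be the set of its $L$-Lipschitz members, and $\underline{\mathcal U}_\Delta=\{U\in\underline{\mathfrak U}:\sum_i\overline{\mathcal C}_i(U)\le\Delta\}$. For $\epsilon_0>0$ let $\mathcal Y=\{0,\epsilon_0,\dots,\lfloor H/\epsilon_0\rfloor\epsilon_0\}$,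 $d=|\mathcal Y|=\lfloor H/\epsilon_0\rfloor+1$, and let $\overline{\underline{\mathfrak U}}_L\subset\mathbb R^d$ be the set of restrictions to $\mathcal Y$ of functions in $\underline{\mathfrak U}_L$. Let $\overline r^i$ be $r^i$ rounded to a nearest point of $\{0,\epsilon_0,\dots,\lfloor1/\epsilon_0\rfloor\epsilon_0\}$. **Data.** For each $i$ one observes $\tau^{E,i}$ independent trajectories of $\pi^{E,i}$ in $\mathcal M^i$, and, independently, $n_i=\lfloor\tau^i/(S_iA_iH)\rfloor$ independent samples from each $p^i_h(\cdot|s,a)$, whose empirical distributions form $\widehat p^i$. **TRACTOR** (parameters $T,K,\alpha,\overline U_0,\epsilon_0$). Let $\widehat\eta^{E,i}\in\mathbb R^d$ be the categorical projection onto $\mathcal Y$ (a Dirac mass at $y\in(y_j,y_{j+1}]$ is split linearly between the neighbouring grid points $y_j,y_{j+1}$; a mass above $\max\mathcal Y$ is moved to $\max\mathcal Y$) of the empirical distribution of the returns of the expert trajectories in environment $i$. For $t=0,\dots,T-1$: for each $i$ compute, by backward induction over (state, cumulative reward), with any rule that selects a maximizing action, an optimal policy for the MDP with dynamics $\widehat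 p^i$, reward $\overline r^i$ and utility $\overline U_t$; simulate it for $K$ independent episodes under $\widehat p^i$, and let $\widehat\eta^i_t\in\mathbb R^d$ be the empirical distribution of the $\overline r^i$-returns; set $g_t=\sum_i(\widehat\eta^i_t-\widehat\eta^{E,i})$ and $\overline U_{t+1}=\Pi(\overline U_t-\alpha g_t)$, where $\Pi$ is the exact Euclidean projection onto $\overline{\underline{\mathfrak U}}_L$. Output $\widehat U=\frac1T\sum_{t=0}^{T-1}\overline U_t$. **Theorem.** There are universal constants $C>0$ and $k\in\mathbb N$ such that, writing $\mathcal O(x)=Cx$ and $\widetilde{\mathcal O}(x)=C\,x\log^k(e+x)$, the following holds. Let $L>0$, $\epsilon,\delta\in(0,1)$, and $U^E\in\underline{\mathfrak U}_L$ be such that every $\pi^{E,i}$ is optimal for $U^E$, i.e. $J^{\pi^{E,i}}(U^E;p^i,r^i)=J^*(U^E;p^i,r^i)$. Assume that for all $i$ $$\tau^{E,i}\ge\widetilde{\mathcal O}\Big(\frac{N^4H^4L^2}{\epsilon^4}\log\frac{HNL}{\delta\epsilon}\Big),\qquad \tau^i\ge\widetilde{\mathcal O}\Big(\frac{N^2S_iA_iH^5}{\epsilon^2}\Big(S_i+\log\frac{S_iA_iHN}{\delta}\Big)\Big),$$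 and that $$T\ge\mathcal O\Big(\frac{N^4H^4L^2}{\epsilon^4}\Big),\qquad K\ge\widetilde{\mathcal O}\Big(\frac{N^2H^2}{\epsilon^2}\log\frac{NT}{\delta}\Big),\qquad \epsilon_0=\frac{\epsilon^2}{80N^2L^2H},\qquad \alpha=\frac{H\sqrt{\lfloor H/\epsilon_0\rfloor-1}}{2N\sqrt T},$$ and let $\overline U_0\in\overline{\underline{\mathfrak U}}_L$ be arbitrary. Then, with probability at least $1-\delta$ (over the data and the simulated episodes), every $U\in\underline{\mathfrak U}_L$ with $U(y)=\widehat U(y)$ for all $y\in\mathcal Y$ belongs to $\underline{\mathcal U}_\epsilon$. -/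

import Mathlib

namespace UL

/-! ### Markov decision processes, non-Markovian policies, return distributions -/

/-- A tabular episodic MDP with horizon `H`. Stages are indexed from `0` to `H - 1`. -/
structure MDP (S A : Type*) (H : ℕ) where
  /-- initial state -/
  s0 : S
  /-- transition model -/
  p : Fin H → S → A → PMF S
  /-- deterministic reward -/
  r : Fin H → S → A → ℝ
  r_mem : ∀ h s a, r h s a ∈ Set.Icc (0 : ℝ) 1

/-- A deterministic, possibly non-Markovian policy: at each stage `h` it maps the past state-action
pairs and the current state to an action. -/
abbrev Policy (S A : Type*) (H : ℕ) := (h : Fin H) → (Fin h → S × A) → S → A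

/-- The sum of the rewards along the first `h` state-action pairs (with values in `ℝ`, or in `ℕ`
for rewards that are counted in units of the discretization step). -/
def cumReward {S A β : Type*} [AddCommMonoid β] {H : ℕ} (r : Fin H → S → A → β) {h : ℕ}
    (hh : h ≤ H) (ω : Fin h → S × A) : β :=
  ∑ j : Fin h, r (Fin.castLE hh j) (ω j).1 (ω j).2

/-- The law of the first `h` state-action pairs together with the state that follows them, when
`π` is played from `s0` under the dynamics `p`. -/
noncomputable def trajLaw {S A : Type*} {H : ℕ} (s0 : S) (p : Fin H → S → A → PMF S)
    (π : Policy S A H) : (h : ℕ) → h ≤ H → PMF ((Fin h → S × A) × S)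
  | 0, _ => PMF.pure (Fin.elim0, s0)
  | h + 1, hh =>
    (trajLaw s0 p π h (Nat.le_of_succ_le hh)).bind fun ω =>
      (p ⟨h, hh⟩ ω.2 (π ⟨h, hh⟩ ω.1 ω.2)).map fun s' =>
        (Fin.snoc (α := fun _ => S × A) ω.1 (ω.2, π ⟨h, hh⟩ ω.1 ω.2), s')

/-- Complete trajectories `(s_1, a_1, …, s_H, a_H, s_{H+1})`. -/
abbrev Traj (S A : Type*) (H : ℕ) := (Fin H → S × A) × S

/-- The performance `J^π(U; p, r)`: the expected utility of the return. -/
noncomputable def perf {S A : Type*} [Fintype S] [Fintype A] {H : ℕ} (M : MDP S A H)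
    (U : ℝ → ℝ) (π : Policy S A H) : ℝ :=
  ∑ ω : Traj S A H, (trajLaw M.s0 M.p π H le_rfl ω).toReal * U (cumReward M.r le_rfl ω.1)

/-- The optimal performance `J^*(U; p, r)` (a maximum: there are finitely many policies). -/
noncomputable def optPerf {S A : Type*} [Fintype S] [Fintype A] {H : ℕ} (M : MDP S A H)
    (U : ℝ → ℝ) : ℝ :=
  ⨆ π : Policy S A H, perf M U π

/-- The (non)compatibility of `U` with the policy `πE` in `M`. -/
noncomputable def nonCompat {S A : Type*} [Fintype S] [Fintype A] {H : ℕ} (M : MDP S A H)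
    (πE : Policy S A H) (U : ℝ → ℝ) : ℝ :=
  optPerf M U - perf M U πE

/-! ### Utilities -/

/-- Increasing (not necessarily strictly) continuous utilities `U : [0,H] → [0,H]` with `U 0 = 0`
and `U H = H`. Values outside `[0,H]` are irrelevant. -/
def incUtil (H : ℕ) : Set (ℝ → ℝ) :=
  {U | Set.MapsTo U (Set.Icc 0 (H : ℝ)) (Set.Icc 0 (H : ℝ)) ∧ U 0 = 0 ∧ U H = H ∧
    MonotoneOn U (Set.Icc 0 (H : ℝ)) ∧ ContinuousOn U (Set.Icc 0 (H : ℝ))}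

/-- The `L`-Lipschitz increasing utilities. -/
def incUtilLip (H : ℕ) (L : ℝ) : Set (ℝ → ℝ) :=
  {U | U ∈ incUtil H ∧ ∀ x ∈ Set.Icc 0 (H : ℝ), ∀ y ∈ Set.Icc 0 (H : ℝ),
    |U x - U y| ≤ L * |x - y|}

/-- The increasing utilities whose total (non)compatibility with the `N` demonstrating policies is
at most `Δ`. -/
def relaxedFeasible {N H : ℕ} {S A : Fin N → Type*} [∀ i, Fintype (S i)] [∀ i, Fintype (A i)]
    (M : ∀ i, MDP (S i) (A i) H) (πE : ∀ i, Policy (S i) (A i) H) (Δ : ℝ) : Set (ℝ → ℝ) :=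
  {U | U ∈ incUtil H ∧ ∑ i, nonCompat (M i) (πE i) U ≤ Δ}

/-! ### Discretization -/

/-- The number `d` of points of the grid `{0, ε₀, 2ε₀, …, ⌊H/ε₀⌋ε₀}`. -/
noncomputable abbrev gridCard (H : ℕ) (ε₀ : ℝ) : ℕ := ⌊(H : ℝ) / ε₀⌋₊ + 1

/-- Vectors indexed by the grid; the coordinate `k` is the value at the grid point `k * ε₀`. -/
abbrev GridVec (H : ℕ) (ε₀ : ℝ) := EuclideanSpace ℝ (Fin (gridCard H ε₀))

/-- The restrictions to the grid of the increasing `L`-Lipschitz utilities. -/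
def discUtil (H : ℕ) (L ε₀ : ℝ) : Set (GridVec H ε₀) :=
  {v | ∃ U ∈ incUtilLip H L, ∀ k, v k = U ((k : ℕ) * ε₀)}

/-- The value of a grid vector at the grid point `k * ε₀`, as a function of `k : ℕ` (zero outside
the grid, which is never reached by the algorithms). -/
noncomputable def gridVal {H : ℕ} {ε₀ : ℝ} (v : GridVec H ε₀) (k : ℕ) : ℝ :=
  if hk : k < gridCard H ε₀ then v ⟨k, hk⟩ else 0

/-- The index of a nearest point to `x` in `{0, ε₀, …, ⌊1/ε₀⌋ε₀}`. -/
noncomputable def roundIdx (ε₀ x : ℝ) : ℕ := min ⌊x / ε₀ + 1 / 2⌋₊ ⌊1 / ε₀⌋₊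

theorem roundIdx_nearest {ε₀ x : ℝ} (hε : 0 < ε₀) (hx : 0 ≤ x) (k : ℕ) (hk : k ≤ ⌊1 / ε₀⌋₊) :
    |x - roundIdx ε₀ x * ε₀| ≤ |x - k * ε₀| := by
  obtain ⟨z, rfl⟩ : ∃ z, x = z * ε₀ := ⟨x / ε₀, by field_simp⟩
  have hz : 0 ≤ z := nonneg_of_mul_nonneg_left hx hε
  rw [← sub_mul, ← sub_mul, abs_mul, abs_mul]
  refine mul_le_mul_of_nonneg_right ?_ (abs_nonneg _)
  have e : z * ε₀ / ε₀ = z := by field_simp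
  unfold roundIdx
  rw [e]
  have h1 := Nat.floor_le (a := z + 1 / 2) (by linarith)
  have h2 := Nat.lt_floor_add_one (z + 1 / 2)
  set j := ⌊z + 1 / 2⌋₊
  rcases le_total j ⌊1 / ε₀⌋₊ with h | h
  · rw [min_eq_left h]
    rcases lt_trichotomy k j with hkj | hkj | hkj
    · have : (k : ℝ) + 1 ≤ j := by exact_mod_cast hkj
      rw [abs_le]
      have := le_abs_self (z - k)
      constructor <;> linarith
    · rw [hkj]
    · have : (j : ℝ) + 1 ≤ k := by exact_mod_cast hkj
      rw [abs_le]
      have := neg_le_abs (z - k)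
      constructor <;> linarith
  · rw [min_eq_right h]
    have a1 : (k : ℝ) ≤ (⌊1 / ε₀⌋₊ : ℝ) := by exact_mod_cast hk
    have a2 : ((⌊1 / ε₀⌋₊ : ℕ) : ℝ) ≤ j := by exact_mod_cast h
    rcases eq_or_lt_of_le hk with hk' | hk'
    · rw [hk']
    · have a3 : (k : ℝ) + 1 ≤ (⌊1 / ε₀⌋₊ : ℝ) := by exact_mod_cast hk'
      rw [abs_le]
      have := le_abs_self (z - k)
      constructor <;> linarith

/-- The discretized reward, in units of `ε₀`. -/
noncomputable def MDP.rIdx {S A : Type*} {H : ℕ} (M : MDP S A H) (ε₀ : ℝ) (h : Fin H) (s : S)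
    (a : A) : ℕ :=
  roundIdx ε₀ (M.r h s a)

/-- The weight that the categorical projection of the Dirac mass at `y` onto the grid puts on the
grid point `k * ε₀`. For `0 < y ≤ ⌊H/ε₀⌋ε₀` the neighbouring grid points are `(j-1)ε₀ < y ≤ jε₀`
with `j = ⌈y/ε₀⌉`. -/
noncomputable def catProj (H : ℕ) (ε₀ y : ℝ) (k : ℕ) : ℝ :=
  if y ≤ 0 then (if k = 0 then 1 else 0)
  else if (⌊(H : ℝ) / ε₀⌋₊ : ℝ) * ε₀ < y then (if k = ⌊(H : ℝ) / ε₀⌋₊ then 1 else 0)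
  else if k + 1 = ⌈y / ε₀⌉₊ then ((⌈y / ε₀⌉₊ : ℝ) * ε₀ - y) / ε₀
  else if k = ⌈y / ε₀⌉₊ then (y - ((⌈y / ε₀⌉₊ : ℝ) - 1) * ε₀) / ε₀
  else 0

/-! ### Sampling -/

open Classical in
/-- The law of a finite family of independent draws, the `i`-th one from `q i`. -/
noncomputable def prodPMF {ι : Type*} [Fintype ι] {α : ι → Type*} [∀ i, Finite (α i)]
    (q : ∀ i, PMF (α i)) : PMF (∀ i, α i) :=
  haveI : ∀ i, Fintype (α i) := fun i => Fintype.ofFinite (α i)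
  PMF.ofFintype (fun x => ∏ i, q i (x i)) (by
    rw [← Fintype.prod_sum]
    refine Finset.prod_eq_one fun i _ => ?_
    rw [← tsum_fintype (L := SummationFilter.unconditional _)]
    exact (q i).tsum_coe)

theorem prodPMF_apply {ι : Type*} [Fintype ι] {α : ι → Type*} [∀ i, Finite (α i)]
    (q : ∀ i, PMF (α i)) (x : ∀ i, α i) : prodPMF q x = ∏ i, q i (x i) := rfl

open Classical in
/-- The empirical distribution of the samples `x 0, …, x (n-1)` (and the Dirac mass at `s` if there
are no samples). -/
noncomputable def empirical {S : Type*} {n : ℕ} (x : Fin n → S) (s : S) : PMF S :=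
  if hn : 0 < n then
    haveI : Nonempty (Fin n) := ⟨⟨0, hn⟩⟩
    (PMF.uniformOfFintype (Fin n)).map x
  else PMF.pure s

/-! ### The sub-routines -/

/-- EXPLORE: number of samples of each triple `(s, a, h)` for a budget of `τ` samples. -/
def samplesPerTriple (S A : Type*) [Fintype S] [Fintype A] (H τ : ℕ) : ℕ :=
  τ / (Fintype.card S * Fintype.card A * H)

/-- EXPLORE: the samples collected from the generative model in one environment. -/
abbrev GenData (S A : Type*) (H n : ℕ) := (Fin H × S × A) × Fin n → S

/-- EXPLORE: the law of these samples. -/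
noncomputable def genLaw {S A : Type*} [Fintype S] [Fintype A] {H : ℕ} (M : MDP S A H) (n : ℕ) :
    PMF (GenData S A H n) :=
  prodPMF fun x => M.p x.1.1 x.1.2.1 x.1.2.2

/-- EXPLORE: the empirical estimate of the transition model. -/
noncomputable def pHat {S A : Type*} {H n : ℕ} (x : GenData S A H n) (h : Fin H) (s : S) (a : A) :
    PMF S :=
  empirical (fun j => x ((h, s, a), j)) s

/-- ERD: the categorical projection of the empirical return distribution of a dataset. -/
noncomputable def erd {S A : Type*} {H n : ℕ} (M : MDP S A H) (ε₀ : ℝ) (D : Fin n → Traj S A H) :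
    GridVec H ε₀ :=
  WithLp.toLp 2 fun k => (∑ j, catProj H ε₀ (cumReward M.r le_rfl (D j).1) k) / n

/-- PLANNING: the optimal value function with `m` stages to go, at the state `s` and cumulative
discretized reward `y * ε₀`, for dynamics `p`, discretized reward and utility `v`. Backward
induction is started one step later, at the end of the episode, from the utility itself. -/
noncomputable def planV {S A : Type*} [Fintype S] {H : ℕ} (M : MDP S A H) {ε₀ : ℝ}
    (p : Fin H → S → A → PMF S) (v : GridVec H ε₀) : (m : ℕ) → m ≤ H → S → ℕ → ℝ
  | 0, _, _, y => gridVal v y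
  | m + 1, hm, s, y =>
    ⨆ a : A, ∑ s', (p ⟨H - (m + 1), by omega⟩ s a s').toReal *
      planV M p v m (Nat.le_of_succ_le hm) s' (y + M.rIdx ε₀ ⟨H - (m + 1), by omega⟩ s a)

/-- PLANNING: the optimal action-value function at stage `h`. -/
noncomputable def planQ {S A : Type*} [Fintype S] {H : ℕ} (M : MDP S A H) {ε₀ : ℝ}
    (p : Fin H → S → A → PMF S) (v : GridVec H ε₀) (h : Fin H) (s : S) (y : ℕ) (a : A) : ℝ :=
  ∑ s', (p h s a s').toReal * planV M p v (H - 1 - h) (by omega) s' (y + M.rIdx ε₀ h s a)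

/-- The greedy policy computed by PLANNING, when `sel` selects the maximizing action, seen as a
non-Markovian policy that depends on the history through the cumulative discretized reward. -/
noncomputable def planPolicy {S A : Type*} [Fintype S] {H : ℕ} (M : MDP S A H) {ε₀ : ℝ}
    (sel : (A → ℝ) → A) (p : Fin H → S → A → PMF S) (v : GridVec H ε₀) : Policy S A H :=
  fun h ω s => sel (planQ M p v h s (cumReward (M.rIdx ε₀) h.isLt.le ω))

/-- ROLLOUT: the law of `K` trajectories simulated with the computed policy in the MDP with
dynamics `p`. -/
noncomputable def rolloutLaw {S A : Type*} [Fintype S] [Fintype A] {H : ℕ} (M : MDP S A H) {ε₀ : ℝ}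
    (sel : (A → ℝ) → A) (p : Fin H → S → A → PMF S) (v : GridVec H ε₀) (K : ℕ) :
    PMF (Fin K → Traj S A H) :=
  prodPMF fun _ => trajLaw M.s0 p (planPolicy M sel p v) H le_rfl

/-- The empirical distribution, on the grid, of the discretized returns of the simulated
trajectories. -/
noncomputable def etaHat {S A : Type*} {H K : ℕ} (M : MDP S A H) (ε₀ : ℝ)
    (D : Fin K → Traj S A H) : GridVec H ε₀ :=
  WithLp.toLp 2 fun k =>
    (∑ j, if cumReward (M.rIdx ε₀) le_rfl (D j).1 = k then (1 : ℝ) else 0) / K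

open Classical in
/-- The Euclidean projection onto `X` (meaningful when a nearest point of `X` exists). -/
noncomputable def euclProj {E : Type*} [NormedAddCommGroup E] (X : Set E) (y : E) : E :=
  if h : ∃ x ∈ X, ∀ z ∈ X, ‖y - x‖ ≤ ‖y - z‖ then h.choose else y

/-! ### TRACTOR -/

section Tractor

variable {N H : ℕ} {S A : Fin N → Type*} [∀ i, Fintype (S i)] [∀ i, Fintype (A i)]

/-- One iteration: from the current utility `v`, the law of the updated utility. -/
noncomputable def tractorStep (M : ∀ i, MDP (S i) (A i) H) (L ε₀ α : ℝ) (K : ℕ)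
    (sel : ∀ i, (A i → ℝ) → A i) (p : ∀ i, Fin H → S i → A i → PMF (S i))
    (ηE : Fin N → GridVec H ε₀) (v : GridVec H ε₀) : PMF (GridVec H ε₀) :=
  (prodPMF fun i => rolloutLaw (M i) (sel i) (p i) v K).map fun D =>
    euclProj (discUtil H L ε₀) (v - α • ∑ i, (etaHat (M i) ε₀ (D i) - ηE i))

/-- The joint law of the sum of the first `t` iterates (numbered from `0`) and of the iterate
number `t`. -/
noncomputable def tractorLoop (M : ∀ i, MDP (S i) (A i) H) (L ε₀ α : ℝ) (K : ℕ)
    (sel : ∀ i, (A i → ℝ) → A i) (p : ∀ i, Fin H → S i → A i → PMF (S i))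
    (ηE : Fin N → GridVec H ε₀) (v₀ : GridVec H ε₀) :
    ℕ → PMF (GridVec H ε₀ × GridVec H ε₀)
  | 0 => PMF.pure (0, v₀)
  | t + 1 => (tractorLoop M L ε₀ α K sel p ηE v₀ t).bind fun x =>
      (tractorStep M L ε₀ α K sel p ηE x.2).map fun v => (x.1 + x.2, v)

/-- The law of the output of TRACTOR, preceded by the collection of the data: `τE i` trajectories
of the policy `πE i`, and `τ i` samples of the generative model, in each environment `i`. -/
noncomputable def tractor (M : ∀ i, MDP (S i) (A i) H) (πE : ∀ i, Policy (S i) (A i) H)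
    (τE τ : Fin N → ℕ) (L ε₀ α : ℝ) (K T : ℕ) (sel : ∀ i, (A i → ℝ) → A i)
    (v₀ : GridVec H ε₀) : PMF (GridVec H ε₀) :=
  (prodPMF fun i => prodPMF fun _ : Fin (τE i) =>
      trajLaw (M i).s0 (M i).p (πE i) H le_rfl).bind fun DE =>
    (prodPMF fun i => genLaw (M i) (samplesPerTriple (S i) (A i) H (τ i))).bind fun X =>
      (tractorLoop M L ε₀ α K sel (fun i => pHat (X i)) (fun i => erd (M i) ε₀ (DE i)) v₀ T).map
        fun x => (1 / (T : ℝ)) • x.1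

end Tractor

/-- `C * x * log^k (e + x)`: the quantity denoted `Õ(x)`, for given constants `C` and `k`. -/
noncomputable def softO (C : ℝ) (k : ℕ) (x : ℝ) : ℝ :=
  C * x * Real.log (Real.exp 1 + x) ^ k

end UL

/-!
The output of TRACTOR is nearly compatible with the experts because projected subgradient descent
solves, approximately, the convex problem of minimizing `U ↦ ∑ i, nonCompat (M i) (πE i) U`. For a
grid utility `v`, the *advantage* of policies `π` over the estimated return distributions of the
experts is linear in `v`, and one round of planning and simulation produces an approximate
subgradient `∑ i, (etaHat i - ηE i)` of its maximum over `π`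
(`advantage_le_of_rolloutClose`). At the expert utility `UE` every advantage is nearly nonpositive
since the experts are optimal for it (`advantage_gridRestrict_le`). Hence the usual telescoping
argument bounds the advantages for the sum of the iterates; this bound, `RegretBound`, is an
invariant of the loop which is lost at each iteration with a small probability
(`toOuterMeasure_tractorLoop_le`). A small advantage for the average iterate gives near
compatibility of every utility that extends it (`sum_nonCompat_le_of_advantage_le`).

The estimation errors have to be uniform over the utilities, because the iterates depend on the
data. No covering of the class of utilities is needed for this.

* Expert data. By summation by parts (`interp_eq_sum_catTail`) an increasing utility with values in
  `[0, H]` is a combination, with nonnegative coefficients of total weight at most `H`, of indicators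
  of upper tails of the grid. A union bound over the grid points controls all of them.
* Transition model. Hoeffding's inequality and a union bound over the subsets of the state space
  control the expectations of all bounded functions of the next state, and the simulation lemma
  (`mean_trajLaw_le_of_forall`) propagates this to all history-dependent policies and all utilities.
* Simulated episodes. Given the past, the current iterate and `UE` are two fixed utilities, to which
  Hoeffding's inequality applies.

Planning by backward induction is optimal among history-dependent policies
(`discPerf_le_discPerf_planPolicy`), and the discretization costs at most `L * (H * ε₀)` for the
rewards and `L * ε₀` for the categorical projection.

The sample size required for the experts carries the factor `log (H * N * L / (δ * ε))`, which may be
arbitrarily small. This only happens for `N = H = 1` and `L` close to `1`, when all utilities of the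
class are so close to `UE` that the conclusion holds for every output
(`sum_nonCompat_le_of_lipschitz`, `degenerate_error_le`).
-/

namespace UL

/-! ### Expectations and tail bounds for discrete laws -/

section Probability

variable {α β : Type*}

/-- The expectation of a real function under a law on a finite type. -/
noncomputable def mean [Fintype α] (q : PMF α) (f : α → ℝ) : ℝ := ∑ x, (q x).toReal * f x

theorem sum_toReal_eq_one [Fintype α] (q : PMF α) : ∑ x, (q x).toReal = 1 := by
  rw [← ENNReal.toReal_sum fun x _ => q.apply_ne_top x, ← tsum_fintype (L := .unconditional _),
    q.tsum_coe, ENNReal.toReal_one]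

theorem mean_const [Fintype α] (q : PMF α) (c : ℝ) : mean q (fun _ => c) = c := by
  rw [mean, ← Finset.sum_mul, sum_toReal_eq_one, one_mul]

theorem mean_mono [Fintype α] (q : PMF α) {f g : α → ℝ} (h : ∀ x, f x ≤ g x) :
    mean q f ≤ mean q g :=
  Finset.sum_le_sum fun x _ => mul_le_mul_of_nonneg_left (h x) ENNReal.toReal_nonneg

theorem mean_add [Fintype α] (q : PMF α) (f g : α → ℝ) :
    mean q (fun x => f x + g x) = mean q f + mean q g := by
  simp only [mean, mul_add, Finset.sum_add_distrib]

theorem mean_sub [Fintype α] (q : PMF α) (f g : α → ℝ) :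
    mean q (fun x => f x - g x) = mean q f - mean q g := by
  simp only [mean, mul_sub, Finset.sum_sub_distrib]

theorem mean_const_mul [Fintype α] (q : PMF α) (c : ℝ) (f : α → ℝ) :
    mean q (fun x => c * f x) = c * mean q f := by
  simp only [mean, Finset.mul_sum, mul_left_comm]

theorem mean_sum [Fintype α] {ι : Type*} (q : PMF α) (s : Finset ι) (f : ι → α → ℝ) :
    mean q (fun x => ∑ i ∈ s, f i x) = ∑ i ∈ s, mean q (f i) := by
  simp only [mean, Finset.mul_sum]
  exact Finset.sum_comm

theorem mean_mem_Icc [Fintype α] (q : PMF α) {f : α → ℝ} {a b : ℝ}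
    (h : ∀ x, f x ∈ Set.Icc a b) : mean q f ∈ Set.Icc a b :=
  ⟨(mean_const q a).symm.le.trans (mean_mono q fun x => (h x).1),
    (mean_mono q fun x => (h x).2).trans (mean_const q b).le⟩

theorem mean_le_mean_add [Fintype α] (q : PMF α) {f g : α → ℝ} {c : ℝ}
    (h : ∀ x, f x ≤ g x + c) : mean q f ≤ mean q g + c :=
  (mean_mono q h).trans_eq (by rw [mean_add, mean_const])

theorem mean_pure [Fintype α] (a : α) (f : α → ℝ) : mean (PMF.pure a) f = f a := by
  classical
  simp [mean, PMF.pure_apply, apply_ite ENNReal.toReal]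

theorem mean_bind [Fintype α] [Fintype β] (p : PMF α) (q : α → PMF β) (f : β → ℝ) :
    mean (p.bind q) f = mean p fun x => mean (q x) f := by
  have h (y : β) : (p.bind q y).toReal = ∑ x, (p x).toReal * (q x y).toReal := by
    rw [PMF.bind_apply, tsum_fintype, ENNReal.toReal_sum]
    · simp only [ENNReal.toReal_mul]
    · exact fun x _ => ENNReal.mul_ne_top (p.apply_ne_top x) ((q x).apply_ne_top y)
  simp only [mean, h, Finset.sum_mul, Finset.mul_sum, mul_assoc]
  exact Finset.sum_comm

theorem mean_map [Fintype α] [Fintype β] (p : PMF α) (g : α → β) (f : β → ℝ) :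
    mean (p.map g) f = mean p fun x => f (g x) := by
  rw [← PMF.bind_pure_comp, mean_bind]
  simp only [Function.comp, mean_pure]

open Classical in
theorem toOuterMeasure_eq_mean [Fintype α] (p : PMF α) (s : Set α) :
    p.toOuterMeasure s = ENNReal.ofReal (mean p (s.indicator 1)) := by
  rw [PMF.toOuterMeasure_apply_fintype, mean,
    ENNReal.ofReal_sum_of_nonneg fun x _ => by
      by_cases h : x ∈ s <;> simp [h]]
  refine Finset.sum_congr rfl fun x _ => ?_
  by_cases h : x ∈ s <;> simp [h, ENNReal.ofReal_toReal, p.apply_ne_top]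

theorem toOuterMeasure_univ (p : PMF α) : p.toOuterMeasure Set.univ = 1 :=
  (p.toOuterMeasure_apply_eq_one_iff _).2 (Set.subset_univ _)

theorem toOuterMeasure_exists_le {ι : Type*} [Fintype ι] (p : PMF α) (B : ι → Set α) {c : ℝ}
    (hB : ∀ i, p.toOuterMeasure (B i) ≤ ENNReal.ofReal c) :
    p.toOuterMeasure {x | ∃ i, x ∈ B i} ≤ ENNReal.ofReal (Fintype.card ι * c) := by
  rw [Set.ofPred_exists]
  refine (MeasureTheory.measure_iUnion_fintype_le p.toOuterMeasure B).trans ?_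
  refine (Finset.sum_le_sum fun i _ => hB i).trans_eq ?_
  rw [Finset.sum_const, Finset.card_univ, ENNReal.ofReal_mul (Nat.cast_nonneg _),
    ENNReal.ofReal_natCast, nsmul_eq_mul]

/-- If a property holds with probability at least `1 - a` for the first draw and, given that it
holds, a second property holds with conditional probability at least `1 - b` for the second draw,
then the latter holds with probability at least `1 - (a + b)`. -/
theorem toOuterMeasure_bind_le (p : PMF α) (q : α → PMF β) (s : Set α) (t : Set β) {a b : ℝ}
    (ha : 0 ≤ a) (hb : 0 ≤ b) (hs : p.toOuterMeasure sᶜ ≤ ENNReal.ofReal a)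
    (ht : ∀ x ∈ s, (q x).toOuterMeasure tᶜ ≤ ENNReal.ofReal b) :
    (p.bind q).toOuterMeasure tᶜ ≤ ENNReal.ofReal (a + b) := by
  classical
  rw [PMF.toOuterMeasure_bind_apply, ENNReal.ofReal_add ha hb]
  calc ∑' x, p x * (q x).toOuterMeasure tᶜ
      ≤ ∑' x, (sᶜ.indicator p x + p x * ENNReal.ofReal b) := by
        refine ENNReal.tsum_le_tsum fun x => ?_
        by_cases hx : x ∈ s
        · exact le_add_left (mul_le_mul_right (ht x hx) _)
        · refine le_add_right ?_
          rw [Set.indicator_of_mem (Set.mem_compl hx)]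
          refine mul_le_of_le_one_right' ?_
          rw [← toOuterMeasure_univ (q x)]
          exact (q x).toOuterMeasure.mono (Set.subset_univ _)
    _ = p.toOuterMeasure sᶜ + ENNReal.ofReal b := by
        rw [ENNReal.tsum_add, ENNReal.tsum_mul_right, p.tsum_coe, one_mul,
          PMF.toOuterMeasure_apply]
    _ ≤ _ := by gcongr

theorem ofReal_one_sub_le_toOuterMeasure (p : PMF α) (s : Set α) {a : ℝ} (ha : 0 ≤ a)
    (hs : p.toOuterMeasure sᶜ ≤ ENNReal.ofReal a) :
    ENNReal.ofReal (1 - a) ≤ p.toOuterMeasure s := by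
  rw [ENNReal.ofReal_sub _ ha, ENNReal.ofReal_one, tsub_le_iff_right, ← toOuterMeasure_univ p,
    ← Set.union_compl_self s]
  exact (MeasureTheory.measure_union_le s sᶜ).trans (by gcongr)

/-! ### Independent draws -/

section Product

variable {ι : Type*} [Fintype ι] [DecidableEq ι] {X : ι → Type*} [∀ i, Fintype (X i)]

theorem mean_prodPMF_prod (q : ∀ i, PMF (X i)) (f : ∀ i, X i → ℝ) :
    mean (prodPMF q) (fun x => ∏ i, f i (x i)) = ∏ i, mean (q i) (f i) := by
  simp only [mean, prodPMF_apply, ENNReal.toReal_prod, ← Finset.prod_mul_distrib]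
  rw [Fintype.prod_sum]

theorem toOuterMeasure_prodPMF_eval (q : ∀ i, PMF (X i)) (i : ι) (s : Set (X i)) :
    (prodPMF q).toOuterMeasure {x | x i ∈ s} = (q i).toOuterMeasure s := by
  classical
  rw [toOuterMeasure_eq_mean, toOuterMeasure_eq_mean]
  have h := mean_prodPMF_prod q (Function.update (fun _ _ => 1) i (s.indicator 1))
  rw [Finset.prod_eq_single i _ (by simp), Function.update_self] at h
  · rw [← h]
    congr 2 with x
    rw [Finset.prod_eq_single i _ (by simp), Function.update_self]
    · rfl
    · intro j _ hj
      rw [Function.update_of_ne hj]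
  · intro j _ hj
    rw [Function.update_of_ne hj, mean_const]

/-- Hoeffding's lemma for a bounded function under a discrete law. -/
theorem mean_exp_le [Fintype α] (q : PMF α) {f : α → ℝ} {b : ℝ} (hf : ∀ x, f x ∈ Set.Icc 0 b)
    (t : ℝ) : mean q (fun x => Real.exp (t * (f x - mean q f))) ≤ Real.exp (t ^ 2 * b ^ 2 / 8) := by
  let _ : MeasurableSpace α := ⊤
  have hm (g : α → ℝ) : mean q g = ∫ x, g x ∂q.toMeasure := by
    rw [PMF.integral_eq_sum]; rfl
  have h := (ProbabilityTheory.hasSubgaussianMGF_of_mem_Icc (μ := q.toMeasure) (X := f) (a := 0)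
    (b := b) (measurable_from_top).aemeasurable (Filter.Eventually.of_forall hf)).mgf_le t
  rw [ProbabilityTheory.mgf, ← hm, ← hm] at h
  refine h.trans_eq ?_
  congr 1
  simp [div_pow]
  ring

/-- **Hoeffding's inequality** for a sum of bounded functions of independent draws, over a part `J`
of the draws. -/
theorem hoeffding (q : ∀ i, PMF (X i)) (J : Finset ι) {f : ∀ i, X i → ℝ} {b : ℝ} (hb : 0 < b)
    (hf : ∀ i ∈ J, ∀ x, f i x ∈ Set.Icc 0 b) (hJ : J.Nonempty) {t : ℝ} (ht : 0 ≤ t) :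
    (prodPMF q).toOuterMeasure {x | J.card * t < ∑ i ∈ J, (f i (x i) - mean (q i) (f i))} ≤
      ENNReal.ofReal (Real.exp (-(2 * J.card * (t / b) ^ 2))) := by
  classical
  rw [toOuterMeasure_eq_mean]
  refine ENNReal.ofReal_le_ofReal ?_
  -- the exponent that optimizes the Chernoff bound
  set l : ℝ := 4 * t / b ^ 2 with hl
  have hl0 : 0 ≤ l := by positivity
  have h1 := mean_prodPMF_prod q fun i y =>
    if i ∈ J then Real.exp (l * (f i y - mean (q i) (f i))) else 1
  have h2 : ∏ i, mean (q i) (fun y =>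
      if i ∈ J then Real.exp (l * (f i y - mean (q i) (f i))) else 1) ≤
      Real.exp (J.card * (l ^ 2 * b ^ 2 / 8)) := by
    rw [← nsmul_eq_mul, Real.exp_nsmul, ← Finset.prod_const, ← Finset.prod_subset J.subset_univ]
    · refine Finset.prod_le_prod (fun i hi => ?_) fun i hi => ?_
      · refine Finset.sum_nonneg fun y _ => mul_nonneg ENNReal.toReal_nonneg ?_
        split_ifs
        all_goals positivity
      · simp only [hi, if_true]
        exact mean_exp_le (q i) (hf i hi) l
    · intro i _ hi
      simp only [hi, if_false, mean_const]
  have h3 (x : ∀ i, X i) : ∏ i, (if i ∈ J then Real.exp (l * (f i (x i) - mean (q i) (f i))) else 1)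
      = Real.exp (l * ∑ i ∈ J, (f i (x i) - mean (q i) (f i))) := by
    rw [Finset.prod_ite_mem, Finset.univ_inter, ← Real.exp_sum, Finset.mul_sum]
  simp only [h3] at h1
  calc _ ≤ mean (prodPMF q) (fun x => Real.exp (-(l * (J.card * t))) *
          Real.exp (l * ∑ i ∈ J, (f i (x i) - mean (q i) (f i)))) := by
        refine mean_mono _ fun x => ?_
        rw [Set.indicator_apply]
        split_ifs with h
        · rw [← Real.exp_add, Pi.one_apply, Real.one_le_exp_iff]
          have := mul_le_mul_of_nonneg_left (le_of_lt h) hl0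
          linarith
        · positivity
    _ ≤ Real.exp (-(l * (J.card * t))) * Real.exp (J.card * (l ^ 2 * b ^ 2 / 8)) := by
        rw [mean_const_mul, h1]
        exact mul_le_mul_of_nonneg_left h2 (Real.exp_nonneg _)
    _ = _ := by
        rw [← Real.exp_add]
        congr 1
        rw [hl]
        field_simp
        ring

end Product

/-- Hoeffding's inequality for the average of `n` independent draws from the same law. -/
theorem hoeffding_average [Fintype α] (q : PMF α) {n : ℕ} (hn : 0 < n) {f : α → ℝ} {b : ℝ}
    (hb : 0 < b) (hf : ∀ x, f x ∈ Set.Icc 0 b) {t : ℝ} (ht : 0 ≤ t) :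
    (prodPMF fun _ : Fin n => q).toOuterMeasure {x | mean q f + t < (∑ j, f (x j)) / n} ≤
      ENNReal.ofReal (Real.exp (-(2 * n * (t / b) ^ 2))) := by
  have h := hoeffding (fun _ : Fin n => q) Finset.univ (f := fun _ => f) hb (fun _ _ => hf)
    ⟨⟨0, hn⟩, Finset.mem_univ _⟩ ht
  rw [Finset.card_univ, Fintype.card_fin] at h
  convert h using 4 with x
  rw [Finset.sum_sub_distrib, Finset.sum_const, Finset.card_univ, Fintype.card_fin, nsmul_eq_mul,
    lt_div_iff₀ (by positivity)]
  constructor <;> intro h <;> linarith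

/-- Hoeffding's inequality for deviations below the expectation. -/
theorem hoeffding_average_lower [Fintype α] (q : PMF α) {n : ℕ} (hn : 0 < n) {f : α → ℝ} {b : ℝ}
    (hb : 0 < b) (hf : ∀ x, f x ∈ Set.Icc 0 b) {t : ℝ} (ht : 0 ≤ t) :
    (prodPMF fun _ : Fin n => q).toOuterMeasure {x | (∑ j, f (x j)) / n + t < mean q f} ≤
      ENNReal.ofReal (Real.exp (-(2 * n * (t / b) ^ 2))) := by
  convert hoeffding_average q hn (f := fun x => b - f x) hb
    (fun x => ⟨by linarith [(hf x).2], by linarith [(hf x).1]⟩) ht using 4 with x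
  rw [mean_sub, mean_const, Finset.sum_sub_distrib, Finset.sum_const, Finset.card_univ,
    Fintype.card_fin, nsmul_eq_mul, sub_div, mul_div_cancel_left₀ _ (by positivity)]
  constructor <;> intro h <;> linarith

end Probability

/-! ### Trajectories: the simulation lemma and dynamic programming -/

section Trajectories

variable {S A : Type*} {H : ℕ}

theorem cumReward_snoc {β : Type*} [AddCommMonoid β] (r : Fin H → S → A → β) {h : ℕ}
    (hh : h + 1 ≤ H) (ω : Fin h → S × A) (x : S × A) :
    cumReward r hh (Fin.snoc (α := fun _ => S × A) ω x) =
      cumReward r (Nat.le_of_succ_le hh) ω + r ⟨h, hh⟩ x.1 x.2 := by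
  rw [cumReward, Fin.sum_univ_castSucc]
  simp only [Fin.snoc_castSucc, Fin.snoc_last]
  rfl

theorem planV_congr [Fintype S] (M : MDP S A H) {ε₀ : ℝ} (p : Fin H → S → A → PMF S) (v : GridVec H ε₀)
    {m m' : ℕ} (e : m = m') (hm : m ≤ H) (hm' : m' ≤ H) (s : S) (y : ℕ) :
    planV M p v m hm s y = planV M p v m' hm' s y := by
  subst e; rfl

theorem planV_eq_iSup_planQ [Fintype S] (M : MDP S A H) {ε₀ : ℝ} (p : Fin H → S → A → PMF S)
    (v : GridVec H ε₀) (h : Fin H) (s : S) (y : ℕ) :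
    planV M p v (H - h) (Nat.sub_le _ _) s y = ⨆ a, planQ M p v h s y a := by
  obtain ⟨h, hh⟩ := h
  rw [planV_congr M p v (show H - h = (H - 1 - h) + 1 by omega) _ (by omega), planV]
  have e : (⟨H - (H - 1 - h + 1), by omega⟩ : Fin H) = ⟨h, hh⟩ := Fin.ext (by simp; omega)
  simp only [planQ, e]

variable [Fintype S] [Fintype A]

theorem mean_trajLaw_succ (s0 : S) (p : Fin H → S → A → PMF S) (π : Policy S A H) {h : ℕ}
    (hh : h + 1 ≤ H) (F : (Fin (h + 1) → S × A) × S → ℝ) :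
    mean (trajLaw s0 p π (h + 1) hh) F =
      mean (trajLaw s0 p π h (Nat.le_of_succ_le hh)) fun ω =>
        mean (p ⟨h, hh⟩ ω.2 (π ⟨h, hh⟩ ω.1 ω.2)) fun s' =>
          F (Fin.snoc (α := fun _ => S × A) ω.1 (ω.2, π ⟨h, hh⟩ ω.1 ω.2), s') := by
  rw [trajLaw, mean_bind]
  simp only [mean_map]

/-- If no event is more likely by more than `t` under `q` than under `q'`, then expectations of
functions with values in `[0, b]` exceed each other by at most `b * t`. -/
theorem mean_le_mean_add_of_sum_le {q q' : PMF S} {t b : ℝ}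
    (h : ∀ B : Finset S, ∑ s ∈ B, (q s).toReal ≤ ∑ s ∈ B, (q' s).toReal + t) {V : S → ℝ}
    (hb : 0 ≤ b) (hV : ∀ s, V s ∈ Set.Icc 0 b) : mean q V ≤ mean q' V + b * t := by
  classical
  rw [← sub_le_iff_le_add', mean, mean, ← Finset.sum_sub_distrib]
  -- only the states to which `q` gives more mass than `q'` contribute positively
  calc ∑ s, ((q s).toReal * V s - (q' s).toReal * V s)
      ≤ ∑ s, if (q' s).toReal ≤ (q s).toReal then b * ((q s).toReal - (q' s).toReal) else 0 := by
        refine Finset.sum_le_sum fun s _ => ?_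
        rw [← sub_mul, mul_comm]
        split_ifs with hs
        · exact mul_le_mul_of_nonneg_right (hV s).2 (sub_nonneg.2 hs)
        · exact mul_nonpos_of_nonneg_of_nonpos (hV s).1 (sub_nonpos.2 (le_of_not_ge hs))
    _ ≤ b * t := by
        rw [← Finset.sum_filter, ← Finset.mul_sum, Finset.sum_sub_distrib]
        exact mul_le_mul_of_nonneg_left (sub_le_iff_le_add'.2 (h _)) hb

theorem mean_le_mean_add_of_sum_le' {q q' : PMF S} {t b : ℝ}
    (h : ∀ B : Finset S, ∑ s ∈ B, (q s).toReal ≤ ∑ s ∈ B, (q' s).toReal + t) {V : S → ℝ}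
    (hb : 0 ≤ b) (hV : ∀ s, V s ∈ Set.Icc 0 b) : mean q' V ≤ mean q V + b * t := by
  have := mean_le_mean_add_of_sum_le h (V := fun s => b - V s) hb
    fun s => ⟨by linarith [(hV s).2], by linarith [(hV s).1]⟩
  rw [mean_sub, mean_sub, mean_const, mean_const] at this
  linarith

/-- Simulation lemma: replacing the one-step dynamics, at a cost of at most `t` per stage, changes
the expectation of a bounded function of the first `h` stages by at most `h * t`. -/
theorem mean_trajLaw_le_of_forall (s0 : S) {p p' : Fin H → S → A → PMF S} (π : Policy S A H)
    {b t : ℝ} (hp : ∀ h s a (V : S → ℝ), (∀ s, V s ∈ Set.Icc 0 b) →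
      mean (p h s a) V ≤ mean (p' h s a) V + t) :
    ∀ (h : ℕ) (hh : h ≤ H) (F : (Fin h → S × A) × S → ℝ), (∀ ω, F ω ∈ Set.Icc 0 b) →
      mean (trajLaw s0 p π h hh) F ≤ mean (trajLaw s0 p' π h hh) F + h * t
  | 0, _, F, _ => by simp [trajLaw]
  | h + 1, hh, F, hF => by
    rw [mean_trajLaw_succ, mean_trajLaw_succ]
    refine (mean_le_mean_add _ fun ω => hp _ _ _ _ fun s' => hF _).trans ?_
    have := mean_trajLaw_le_of_forall s0 π hp h (Nat.le_of_succ_le hh) _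
      fun ω => mean_mem_Icc (p' ⟨h, hh⟩ ω.2 (π ⟨h, hh⟩ ω.1 ω.2)) fun s' => hF
        (Fin.snoc (α := fun _ => S × A) ω.1 (ω.2, π ⟨h, hh⟩ ω.1 ω.2), s')
    push_cast
    linarith

/-- The optimal value reached after `h` stages by a trajectory. -/
noncomputable def stageValue (M : MDP S A H) {ε₀ : ℝ} (p : Fin H → S → A → PMF S)
    (v : GridVec H ε₀) (h : ℕ) (hh : h ≤ H) (ω : (Fin h → S × A) × S) : ℝ :=
  planV M p v (H - h) (Nat.sub_le _ _) ω.2 (cumReward (M.rIdx ε₀) hh ω.1)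

theorem mean_stageValue_succ (M : MDP S A H) {ε₀ : ℝ} (p : Fin H → S → A → PMF S)
    (v : GridVec H ε₀) (π : Policy S A H) {h : ℕ} (hh : h + 1 ≤ H) :
    mean (trajLaw M.s0 p π (h + 1) hh) (stageValue M p v (h + 1) hh) =
      mean (trajLaw M.s0 p π h (Nat.le_of_succ_le hh)) fun ω =>
        planQ M p v ⟨h, hh⟩ ω.2 (cumReward (M.rIdx ε₀) (Nat.le_of_succ_le hh) ω.1)
          (π ⟨h, hh⟩ ω.1 ω.2) := by
  rw [mean_trajLaw_succ]
  congr 1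
  funext ω
  simp only [stageValue, cumReward_snoc, planQ]
  refine Finset.sum_congr rfl fun s' _ => ?_
  exact congrArg _ (planV_congr M p v (by omega) _ _ _ _)

/-- The expected utility of the discretized return, for the grid utility `v` and dynamics `p`. -/
noncomputable def discPerf (M : MDP S A H) {ε₀ : ℝ} (p : Fin H → S → A → PMF S)
    (v : GridVec H ε₀) (π : Policy S A H) : ℝ :=
  mean (trajLaw M.s0 p π H le_rfl) fun ω => gridVal v (cumReward (M.rIdx ε₀) le_rfl ω.1)

theorem discPerf_eq_mean_stageValue (M : MDP S A H) {ε₀ : ℝ} (p : Fin H → S → A → PMF S)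
    (v : GridVec H ε₀) (π : Policy S A H) :
    discPerf M p v π = mean (trajLaw M.s0 p π H le_rfl) (stageValue M p v H le_rfl) := by
  unfold discPerf
  congr 1
  funext ω
  rw [stageValue, planV_congr M p v (Nat.sub_self H) _ (Nat.zero_le _), planV]

theorem le_stageValue_zero (M : MDP S A H) {ε₀ : ℝ} (p : Fin H → S → A → PMF S)
    (v : GridVec H ε₀) (π : Policy S A H) : ∀ (h : ℕ) (hh : h ≤ H),
    mean (trajLaw M.s0 p π h hh) (stageValue M p v h hh) ≤
      planV M p v H le_rfl M.s0 0
  | 0, _ => by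
    rw [trajLaw, mean_pure, stageValue]
    exact le_of_eq rfl
  | h + 1, hh => by
    rw [mean_stageValue_succ]
    refine (mean_mono _ fun ω => ?_).trans (le_stageValue_zero M p v π h (Nat.le_of_succ_le hh))
    rw [stageValue, planV_eq_iSup_planQ M p v ⟨h, hh⟩]
    exact le_ciSup (f := fun a => planQ M p v ⟨h, hh⟩ ω.2 _ a) (Set.finite_range _).bddAbove _

theorem mean_stageValue_planPolicy (M : MDP S A H) {ε₀ : ℝ} {sel : (A → ℝ) → A}
    (hsel : ∀ (f : A → ℝ) a, f a ≤ f (sel f)) (p : Fin H → S → A → PMF S)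
    (v : GridVec H ε₀) : ∀ (h : ℕ) (hh : h ≤ H),
    mean (trajLaw M.s0 p (planPolicy M sel p v) h hh) (stageValue M p v h hh) =
      planV M p v H le_rfl M.s0 0
  | 0, _ => by
    rw [trajLaw, mean_pure, stageValue]
    rfl
  | h + 1, hh => by
    rw [mean_stageValue_succ, ← mean_stageValue_planPolicy M hsel p v h (Nat.le_of_succ_le hh)]
    congr 1
    funext ω
    rw [stageValue, planV_eq_iSup_planQ M p v ⟨h, hh⟩]
    have : Nonempty A := ⟨sel 0⟩
    exact le_antisymm (le_ciSup (f := fun a => planQ M p v ⟨h, hh⟩ ω.2 _ a)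
      (Set.finite_range _).bddAbove _) (ciSup_le fun a => hsel _ a)

/-- The policy computed by backward induction is optimal among all history-dependent policies. -/
theorem discPerf_le_discPerf_planPolicy (M : MDP S A H) {ε₀ : ℝ} {sel : (A → ℝ) → A}
    (hsel : ∀ (f : A → ℝ) a, f a ≤ f (sel f)) (p : Fin H → S → A → PMF S) (v : GridVec H ε₀)
    (π : Policy S A H) : discPerf M p v π ≤ discPerf M p v (planPolicy M sel p v) := by
  rw [discPerf_eq_mean_stageValue, discPerf_eq_mean_stageValue,
    mean_stageValue_planPolicy M hsel]
  exact le_stageValue_zero M p v π H le_rfl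

end Trajectories

/-! ### Discretization of the rewards -/

section Rounding

variable {S A : Type*} {H : ℕ}

theorem abs_sub_roundIdx_le {ε₀ x : ℝ} (hε : 0 < ε₀) (hx : x ∈ Set.Icc (0 : ℝ) 1) :
    |x - roundIdx ε₀ x * ε₀| ≤ ε₀ := by
  refine (roundIdx_nearest hε hx.1 ⌊x / ε₀⌋₊ (Nat.floor_mono (by gcongr; exact hx.2))).trans ?_
  have h1 := Nat.floor_le (div_nonneg hx.1 hε.le)
  have h2 := Nat.lt_floor_add_one (x / ε₀)
  rw [le_div_iff₀ hε] at h1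
  rw [div_lt_iff₀ hε] at h2
  rw [abs_le]
  constructor <;> linarith

theorem cumReward_mem_Icc (M : MDP S A H) (ω : Fin H → S × A) :
    cumReward M.r le_rfl ω ∈ Set.Icc (0 : ℝ) H := by
  refine ⟨Finset.sum_nonneg fun j _ => (M.r_mem _ _ _).1, ?_⟩
  refine (Finset.sum_le_sum fun j _ => (M.r_mem _ _ _).2).trans_eq ?_
  simp

theorem abs_cumReward_sub_le (M : MDP S A H) {ε₀ : ℝ} (hε : 0 < ε₀) (ω : Fin H → S × A) :
    |cumReward M.r le_rfl ω - cumReward (M.rIdx ε₀) le_rfl ω * ε₀| ≤ H * ε₀ := by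
  simp only [cumReward, Nat.cast_sum, Finset.sum_mul, ← Finset.sum_sub_distrib]
  refine (Finset.abs_sum_le_sum_abs _ _).trans ((Finset.sum_le_sum fun j _ =>
    abs_sub_roundIdx_le hε (M.r_mem _ _ _)).trans_eq ?_)
  simp

theorem cumReward_rIdx_le (M : MDP S A H) {ε₀ : ℝ} (hε : 0 < ε₀) (ω : Fin H → S × A) :
    cumReward (M.rIdx ε₀) le_rfl ω ≤ ⌊(H : ℝ) / ε₀⌋₊ := by
  refine (Finset.sum_le_sum fun j _ => (min_le_right _ _ : _ ≤ ⌊1 / ε₀⌋₊)).trans ?_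
  rw [Finset.sum_const, Finset.card_univ, Fintype.card_fin, smul_eq_mul]
  refine Nat.le_floor ?_
  push_cast
  rw [← mul_one_div (H : ℝ) ε₀]
  exact mul_le_mul_of_nonneg_left (Nat.floor_le (by positivity)) (Nat.cast_nonneg _)

end Rounding

/-! ### Utilities and their restrictions to the grid -/

section Utilities

variable {H : ℕ} {L ε₀ : ℝ}

theorem one_le_of_mem_incUtilLip (hH : 0 < H) {U : ℝ → ℝ} (hU : U ∈ incUtilLip H L) : 1 ≤ L := by
  have hH' : (0 : ℝ) < H := by exact_mod_cast hH
  have h := hU.2 H ⟨hH'.le, le_rfl⟩ 0 ⟨le_rfl, hH'.le⟩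
  rw [hU.1.2.2.1, hU.1.2.1, sub_zero, abs_of_pos hH'] at h
  exact le_of_mul_le_mul_right (by linarith) hH'

theorem gridPoint_mem_Icc (hε : 0 < ε₀) {k : ℕ} (hk : k < gridCard H ε₀) :
    (k : ℝ) * ε₀ ∈ Set.Icc (0 : ℝ) H := by
  refine ⟨by positivity, ?_⟩
  rw [← le_div_iff₀ hε]
  exact (Nat.cast_le.2 (Nat.lt_succ_iff.1 hk)).trans (Nat.floor_le (by positivity))

/-- The restriction of a function to the grid. -/
noncomputable def gridRestrict (H : ℕ) (ε₀ : ℝ) (U : ℝ → ℝ) : GridVec H ε₀ :=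
  WithLp.toLp 2 fun k => U ((k : ℕ) * ε₀)

theorem gridRestrict_mem_discUtil {U : ℝ → ℝ} (hU : U ∈ incUtilLip H L) :
    gridRestrict H ε₀ U ∈ discUtil H L ε₀ :=
  ⟨U, hU, fun _ => rfl⟩

theorem gridVal_coe (v : GridVec H ε₀) (k : Fin (gridCard H ε₀)) : gridVal v k = v k :=
  dif_pos k.2

theorem gridVal_eq {v : GridVec H ε₀} {U : ℝ → ℝ} (hv : ∀ k, v k = U ((k : ℕ) * ε₀)) {k : ℕ}
    (hk : k ≤ ⌊(H : ℝ) / ε₀⌋₊) : gridVal v k = U (k * ε₀) := by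
  rw [gridVal, dif_pos (Nat.lt_succ_iff.2 hk), hv]

theorem gridVal_add (v w : GridVec H ε₀) (k : ℕ) :
    gridVal (v + w) k = gridVal v k + gridVal w k := by
  unfold gridVal
  split_ifs <;> simp

theorem gridVal_smul (c : ℝ) (v : GridVec H ε₀) (k : ℕ) :
    gridVal (c • v) k = c * gridVal v k := by
  unfold gridVal
  split_ifs <;> simp

theorem gridVal_mem_Icc (hε : 0 < ε₀) {v : GridVec H ε₀} (hv : v ∈ discUtil H L ε₀) (k : ℕ) :
    gridVal v k ∈ Set.Icc (0 : ℝ) H := by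
  obtain ⟨U, hU, hv⟩ := hv
  unfold gridVal
  split_ifs with hk
  · rw [hv]
    exact hU.1.1 (gridPoint_mem_Icc hε hk)
  · exact ⟨le_rfl, Nat.cast_nonneg _⟩

theorem gridVal_zero {v : GridVec H ε₀} (hv : v ∈ discUtil H L ε₀) : gridVal v 0 = 0 := by
  obtain ⟨U, hU, hv⟩ := hv
  rw [gridVal_eq hv (Nat.zero_le _), Nat.cast_zero, zero_mul, hU.1.2.1]

theorem gridVal_le_succ (hε : 0 < ε₀) {v : GridVec H ε₀} (hv : v ∈ discUtil H L ε₀) {k : ℕ}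
    (hk : k < ⌊(H : ℝ) / ε₀⌋₊) : gridVal v k ≤ gridVal v (k + 1) := by
  obtain ⟨U, hU, hv⟩ := hv
  rw [gridVal_eq hv hk.le, gridVal_eq hv hk]
  refine hU.1.2.2.2.1 (gridPoint_mem_Icc hε (by unfold gridCard; omega))
    (gridPoint_mem_Icc hε (by unfold gridCard; omega)) ?_
  gcongr
  simp

theorem incUtilLip_convex_comb {U V : ℝ → ℝ} (hU : U ∈ incUtilLip H L) (hV : V ∈ incUtilLip H L)
    {a b : ℝ} (ha : 0 ≤ a) (hb : 0 ≤ b) (hab : a + b = 1) :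
    (fun x => a * U x + b * V x) ∈ incUtilLip H L := by
  obtain ⟨⟨hU1, hU2, hU3, hU4, hU5⟩, hU6⟩ := hU
  obtain ⟨⟨hV1, hV2, hV3, hV4, hV5⟩, hV6⟩ := hV
  refine ⟨⟨fun x hx => ?_, by simp [hU2, hV2], ?_, fun x hx y hy hxy => ?_,
    (hU5.const_mul a).add (hV5.const_mul b)⟩, fun x hx y hy => ?_⟩
  · exact convex_Icc (0 : ℝ) H (hU1 hx) (hV1 hx) ha hb hab
  · simp only [hU3, hV3, ← add_mul, hab, one_mul]
  · have h1 := hU4 hx hy hxy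
    have h2 := hV4 hx hy hxy
    dsimp only
    gcongr
  · have h1 := mul_le_mul_of_nonneg_left (hU6 x hx y hy) ha
    have h2 := mul_le_mul_of_nonneg_left (hV6 x hx y hy) hb
    rw [← abs_of_nonneg ha, ← abs_mul, abs_of_nonneg ha] at h1
    rw [← abs_of_nonneg hb, ← abs_mul, abs_of_nonneg hb] at h2
    calc |a * U x + b * V x - (a * U y + b * V y)|
        = |a * (U x - U y) + b * (V x - V y)| := by congr 1; ring
      _ ≤ _ := abs_add_le _ _
      _ ≤ a * (L * |x - y|) + b * (L * |x - y|) := add_le_add h1 h2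
      _ = L * |x - y| := by rw [← add_mul, hab, one_mul]

theorem convex_discUtil : Convex ℝ (discUtil H L ε₀) := by
  rintro v ⟨U, hU, hv⟩ w ⟨V, hV, hw⟩ a b ha hb hab
  exact ⟨_, incUtilLip_convex_comb hU hV ha hb hab, fun k => by simp [hv, hw]⟩

/-- The set of grid utilities is the continuous image of a set of functions which is compact for
pointwise convergence, by Tychonoff's theorem. -/
theorem isCompact_discUtil (hε : 0 < ε₀) : IsCompact (discUtil H L ε₀) := by
  set I := Set.Icc (0 : ℝ) H
  set X : Set (ℝ → ℝ) := {U | (∀ x, U x ∈ I) ∧ U 0 = 0 ∧ U H = H ∧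
    (∀ x ∈ I, ∀ y ∈ I, x ≤ y → U x ≤ U y) ∧
    ∀ x ∈ I, ∀ y ∈ I, |U x - U y| ≤ L * |x - y|}
  have hX : IsCompact X := by
    have hc : IsCompact {U : ℝ → ℝ | ∀ x, U x ∈ I} := isCompact_pi_infinite fun _ => isCompact_Icc
    refine hc.of_isClosed_subset ?_ fun U hU => hU.1
    have h (x : ℝ) : Continuous fun U : ℝ → ℝ => U x := continuous_apply x
    simp only [X, Set.ofPred_and, Set.ofPred_forall]
    refine (isClosed_iInter fun x => isClosed_Icc.preimage (h x)).inter
      ((isClosed_eq (h _) continuous_const).inter ((isClosed_eq (h _) continuous_const).inter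
      (IsClosed.inter ?_ ?_)))
    · exact isClosed_iInter fun x => isClosed_iInter fun _ => isClosed_iInter fun y =>
        isClosed_iInter fun _ => isClosed_iInter fun _ => isClosed_le (h x) (h y)
    · exact isClosed_iInter fun x => isClosed_iInter fun _ => isClosed_iInter fun y =>
        isClosed_iInter fun _ => isClosed_le ((h x).sub (h y)).abs continuous_const
  have hcont : Continuous (gridRestrict H ε₀) :=
    (PiLp.continuous_toLp 2 _).comp (continuous_pi fun k => continuous_apply _)
  convert hX.image hcont
  ext v
  constructor
  · rintro ⟨U, ⟨⟨h1, h2, h3, h4, h5⟩, h6⟩, hv⟩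
    -- the values of `U` outside `[0, H]` are replaced by `0`
    classical
    have hI {x : ℝ} (hx : x ∈ I) : I.indicator U x = U x := Set.indicator_of_mem hx _
    refine ⟨I.indicator U, ⟨fun x => ?_, ?_, ?_, ?_, ?_⟩, ?_⟩
    · by_cases hx : x ∈ I
      · rw [hI hx]; exact h1 hx
      · rw [Set.indicator_of_notMem hx]; exact ⟨le_rfl, Nat.cast_nonneg _⟩
    · rw [hI ⟨le_rfl, Nat.cast_nonneg _⟩, h2]
    · rw [hI ⟨Nat.cast_nonneg _, le_rfl⟩, h3]
    · intro x hx y hy hxy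
      rw [hI hx, hI hy]; exact h4 hx hy hxy
    · intro x hx y hy
      rw [hI hx, hI hy]; exact h6 x hx y hy
    · ext k
      rw [hv]
      exact hI (gridPoint_mem_Icc hε k.2)
  · rintro ⟨U, ⟨h1, h2, h3, h4, h5⟩, rfl⟩
    refine gridRestrict_mem_discUtil ⟨⟨fun x _ => h1 x, h2, h3,
      fun x hx y hy => h4 x hx y hy, ?_⟩, h5⟩
    refine (LipschitzOnWith.of_dist_le_mul (K := L.toNNReal) fun x hx y hy => ?_).continuousOn
    rw [Real.dist_eq, Real.dist_eq]
    exact (h5 x hx y hy).trans (mul_le_mul_of_nonneg_right (Real.le_coe_toNNReal L) (abs_nonneg _))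

end Utilities

/-! ### Projected subgradient steps -/

section Projection

variable {E : Type*} [NormedAddCommGroup E]

theorem euclProj_spec {X : Set E} (hX : IsCompact X) (hne : X.Nonempty) (y : E) :
    euclProj X y ∈ X ∧ ∀ z ∈ X, ‖y - euclProj X y‖ ≤ ‖y - z‖ := by
  have h : ∃ x ∈ X, ∀ z ∈ X, ‖y - x‖ ≤ ‖y - z‖ :=
    hX.exists_isMinOn (f := fun x => ‖y - x‖) hne (by fun_prop)
  rw [euclProj, dif_pos h]
  exact h.choose_spec

variable [InnerProductSpace ℝ E]

theorem norm_euclProj_sub_le {X : Set E} (hX : IsCompact X) (hc : Convex ℝ X) {z : E}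
    (hz : z ∈ X) (y : E) : ‖euclProj X y - z‖ ^ 2 ≤ ‖y - z‖ ^ 2 := by
  obtain ⟨h1, h2⟩ := euclProj_spec hX ⟨z, hz⟩ y
  set x := euclProj X y
  have : Nonempty X := ⟨⟨z, hz⟩⟩
  have h3 := (norm_eq_iInf_iff_real_inner_le_zero hc h1).1 (le_antisymm
    (le_ciInf fun w => h2 w w.2)
    (ciInf_le (f := fun w : X => ‖y - w‖) ⟨0, by rintro _ ⟨w, rfl⟩; positivity⟩ ⟨x, h1⟩)) z hz
  have h4 := norm_add_sq_real (y - x) (x - z)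
  rw [sub_add_sub_cancel, ← neg_sub z x, inner_neg_right, norm_neg, norm_sub_rev z x] at h4
  nlinarith [sq_nonneg ‖y - x‖]

/-- One step of projected subgradient descent. -/
theorem inner_le_of_euclProj {X : Set E} (hX : IsCompact X) (hc : Convex ℝ X) {u : E}
    (hu : u ∈ X) (v g : E) {α : ℝ} (hα : 0 < α) :
    inner ℝ g (v - u) ≤
      (‖v - u‖ ^ 2 - ‖euclProj X (v - α • g) - u‖ ^ 2) / (2 * α) + α * ‖g‖ ^ 2 / 2 := by
  have h1 := norm_euclProj_sub_le hX hc hu (v - α • g)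
  have h2 := norm_sub_sq_real (v - u) (α • g)
  rw [sub_right_comm, inner_smul_right, norm_smul, Real.norm_of_nonneg hα.le,
    real_inner_comm] at h2
  rw [h2] at h1
  rw [← sub_le_iff_le_add, le_div_iff₀ (by positivity)]
  nlinarith

end Projection

/-! ### The categorical projection -/

section CategoricalProjection

variable {H : ℕ} {ε₀ : ℝ}

theorem exists_catProj_eq (hε : 0 < ε₀) {y : ℝ} (hy : 0 < y)
    (hy' : y ≤ (⌊(H : ℝ) / ε₀⌋₊ : ℝ) * ε₀) :
    ∃ i < ⌊(H : ℝ) / ε₀⌋₊, i * ε₀ ≤ y ∧ y ≤ (i + 1) * ε₀ ∧ ∀ k, catProj H ε₀ y k =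
      (if k = i then ((i + 1) * ε₀ - y) / ε₀ else 0) +
        if k = i + 1 then (y - i * ε₀) / ε₀ else 0 := by
  obtain ⟨i, hi⟩ : ∃ i, ⌈y / ε₀⌉₊ = i + 1 :=
    Nat.exists_eq_succ_of_ne_zero (Nat.ceil_pos.2 (div_pos hy hε)).ne'
  have h1 : i < ⌊(H : ℝ) / ε₀⌋₊ := by
    rw [← Nat.succ_le_iff, Nat.succ_eq_add_one, ← hi, Nat.ceil_le, div_le_iff₀ hε]
    exact hy'
  have h2 : y ≤ (i + 1) * ε₀ := by
    have := Nat.le_ceil (y / ε₀)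
    rwa [hi, div_le_iff₀ hε, Nat.cast_add_one] at this
  have h3 : i * ε₀ ≤ y := by
    have := Nat.ceil_lt_add_one (div_pos hy hε).le
    rw [hi, Nat.cast_add_one, add_lt_add_iff_right, lt_div_iff₀ hε] at this
    exact this.le
  refine ⟨i, h1, h3, h2, fun k => ?_⟩
  rw [catProj, if_neg hy.not_ge, if_neg hy'.not_gt, hi]
  rcases eq_or_ne k i with rfl | hk
  · simp
  · rcases eq_or_ne k (i + 1) with rfl | hk'
    · simp
    · simp [hk, hk']

theorem catProj_nonneg (hε : 0 < ε₀) (y : ℝ) (k : ℕ) : 0 ≤ catProj H ε₀ y k := by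
  rcases le_or_gt y 0 with h0 | h0
  · rw [catProj, if_pos h0]
    split_ifs <;> norm_num
  rcases lt_or_ge ((⌊(H : ℝ) / ε₀⌋₊ : ℝ) * ε₀) y with h1 | h1
  · rw [catProj, if_neg h0.not_ge, if_pos h1]
    split_ifs <;> norm_num
  obtain ⟨i, -, h2, h3, h4⟩ := exists_catProj_eq hε h0 h1
  rw [h4]
  refine add_nonneg ?_ ?_
  all_goals split_ifs
  · exact div_nonneg (sub_nonneg.2 h3) hε.le
  · exact le_rfl
  · exact div_nonneg (sub_nonneg.2 h2) hε.le
  · exact le_rfl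

theorem sum_catProj (hε : 0 < ε₀) (y : ℝ) :
    ∑ k : Fin (gridCard H ε₀), catProj H ε₀ y k = 1 := by
  rw [Fin.sum_univ_eq_sum_range fun k => catProj H ε₀ y k]
  rcases le_or_gt y 0 with h0 | h0
  · simp [catProj, h0]
  rcases lt_or_ge ((⌊(H : ℝ) / ε₀⌋₊ : ℝ) * ε₀) y with h1 | h1
  · simp [catProj, h0.not_ge, h1]
  obtain ⟨i, hi, h2, h3, h4⟩ := exists_catProj_eq hε h0 h1
  simp only [h4, Finset.sum_add_distrib, Finset.sum_ite_eq', Finset.mem_range]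
  rw [if_pos (by unfold gridCard; omega), if_pos (by unfold gridCard; omega), ← add_div,
    div_eq_one_iff_eq hε.ne']
  ring

theorem abs_gridPoint_sub_le (hε : 0 < ε₀) {y : ℝ} (hy : y ∈ Set.Icc (0 : ℝ) H) {k : ℕ}
    (hk : catProj H ε₀ y k ≠ 0) : |k * ε₀ - y| ≤ ε₀ := by
  rcases le_or_gt y 0 with h0 | h0
  · obtain rfl : y = 0 := le_antisymm h0 hy.1
    obtain rfl : k = 0 := by
      by_contra h
      simp [catProj, h] at hk
    simpa using hε.le
  rcases lt_or_ge ((⌊(H : ℝ) / ε₀⌋₊ : ℝ) * ε₀) y with h1 | h1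
  · obtain rfl : k = ⌊(H : ℝ) / ε₀⌋₊ := by
      by_contra h
      simp [catProj, h0.not_ge, h1, h] at hk
    have h2 := Nat.lt_floor_add_one ((H : ℝ) / ε₀)
    rw [div_lt_iff₀ hε] at h2
    rw [abs_le]
    constructor <;> linarith [hy.2]
  obtain ⟨i, -, h2, h3, h4⟩ := exists_catProj_eq hε h0 h1
  rw [h4] at hk
  rcases eq_or_ne k i with rfl | hki
  · rw [abs_le]
    constructor <;> linarith
  · obtain rfl : k = i + 1 := by
      by_contra h
      simp [hki, h] at hk
    rw [abs_le]
    push_cast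
    constructor <;> linarith

/-- The expectation of the grid utility `v` under the categorical projection of the Dirac mass
at `y`. -/
noncomputable def interp (v : GridVec H ε₀) (y : ℝ) : ℝ :=
  ∑ k : Fin (gridCard H ε₀), catProj H ε₀ y k * v k

theorem abs_interp_sub_le (hε : 0 < ε₀) {L : ℝ} (hL : 0 ≤ L) {U : ℝ → ℝ}
    (hU : U ∈ incUtilLip H L) {v : GridVec H ε₀} (hv : ∀ k, v k = U ((k : ℕ) * ε₀)) {y : ℝ}
    (hy : y ∈ Set.Icc (0 : ℝ) H) : |interp v y - U y| ≤ L * ε₀ := by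
  have e : interp v y - U y =
      ∑ k : Fin (gridCard H ε₀), catProj H ε₀ y k * (v k - U y) := by
    simp only [interp, mul_sub, Finset.sum_sub_distrib, ← Finset.sum_mul, sum_catProj hε, one_mul]
  rw [e]
  refine (Finset.abs_sum_le_sum_abs _ _).trans ?_
  rw [← one_mul (L * ε₀), ← sum_catProj (H := H) hε y, Finset.sum_mul]
  refine Finset.sum_le_sum fun k _ => ?_
  rw [abs_mul, abs_of_nonneg (catProj_nonneg hε _ _)]
  rcases eq_or_ne (catProj H ε₀ y k) 0 with h0 | h0
  · rw [h0, zero_mul, zero_mul]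
  refine mul_le_mul_of_nonneg_left ?_ (catProj_nonneg hε _ _)
  rw [hv]
  exact (hU.2 _ (gridPoint_mem_Icc hε k.2) _ hy).trans
    (mul_le_mul_of_nonneg_left (abs_gridPoint_sub_le hε hy h0) hL)

theorem interp_mem_Icc (hε : 0 < ε₀) {L : ℝ} {v : GridVec H ε₀} (hv : v ∈ discUtil H L ε₀)
    (y : ℝ) : interp v y ∈ Set.Icc (0 : ℝ) H := by
  have h (k : Fin (gridCard H ε₀)) : v k ∈ Set.Icc (0 : ℝ) H := by
    rw [← gridVal_coe]; exact gridVal_mem_Icc hε hv k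
  refine ⟨Finset.sum_nonneg fun k _ => mul_nonneg (catProj_nonneg hε _ _) (h k).1, ?_⟩
  refine (Finset.sum_le_sum fun k _ => mul_le_mul_of_nonneg_left (h k).2
    (catProj_nonneg hε _ _)).trans_eq ?_
  rw [← Finset.sum_mul, sum_catProj hε, one_mul]

/-- The mass that the categorical projection of the Dirac mass at `y` gives to the grid points
above `l * ε₀`. -/
noncomputable def catTail (H : ℕ) (ε₀ y : ℝ) (l : ℕ) : ℝ :=
  ∑ k : Fin (gridCard H ε₀), if l < k then catProj H ε₀ y k else 0

theorem catTail_mem_Icc (hε : 0 < ε₀) (y : ℝ) (l : ℕ) :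
    catTail H ε₀ y l ∈ Set.Icc (0 : ℝ) 1 := by
  constructor
  · refine Finset.sum_nonneg fun k _ => ?_
    split_ifs
    exacts [catProj_nonneg hε _ _, le_rfl]
  · rw [← sum_catProj (H := H) hε y]
    refine Finset.sum_le_sum fun k _ => ?_
    split_ifs
    exacts [le_rfl, catProj_nonneg hε _ _]

/-- Summation by parts: a grid utility is a combination of indicators of upper tails, whose
coefficients are its increments. -/
theorem interp_eq_sum_catTail {L : ℝ} {v : GridVec H ε₀} (hv : v ∈ discUtil H L ε₀) (y : ℝ) :
    interp v y = ∑ l ∈ Finset.range ⌊(H : ℝ) / ε₀⌋₊,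
      (gridVal v (l + 1) - gridVal v l) * catTail H ε₀ y l := by
  have h (k : Fin (gridCard H ε₀)) : v k = ∑ l ∈ Finset.range ⌊(H : ℝ) / ε₀⌋₊,
      if l < k then gridVal v (l + 1) - gridVal v l else 0 := by
    rw [← Finset.sum_filter, show (Finset.range ⌊(H : ℝ) / ε₀⌋₊).filter (· < (k : ℕ)) =
      Finset.range k by ext l; have := k.2; unfold gridCard at this; simp; omega,
      Finset.sum_range_sub, gridVal_zero hv, sub_zero, gridVal_coe]
  simp only [interp, catTail]
  rw [Finset.sum_congr rfl fun k _ => by rw [h k]]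
  simp only [Finset.mul_sum]
  rw [Finset.sum_comm]
  refine Finset.sum_congr rfl fun l _ => Finset.sum_congr rfl fun k _ => ?_
  split_ifs
  · rw [mul_comm]
  · simp

/-- If the average of every upper tail over a sample exceeds its expectation by at most `t`, then
so does, up to the factor `H`, the average of every grid utility. -/
theorem average_interp_le {α : Type*} [Fintype α] (q : PMF α) (G : α → ℝ) {n : ℕ} (hε : 0 < ε₀)
    {t : ℝ} (ht : 0 ≤ t) (x : Fin n → α)
    (hx : ∀ l : Fin ⌊(H : ℝ) / ε₀⌋₊, (∑ j, catTail H ε₀ (G (x j)) l) / n ≤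
      mean q (fun ω => catTail H ε₀ (G ω) l) + t)
    {L : ℝ} {v : GridVec H ε₀} (hv : v ∈ discUtil H L ε₀) :
    (∑ j, interp v (G (x j))) / n ≤ mean q (fun ω => interp v (G ω)) + H * t := by
  simp only [interp_eq_sum_catTail hv]
  rw [Finset.sum_comm, Finset.sum_div, mean_sum]
  calc _ ≤ ∑ l ∈ Finset.range ⌊(H : ℝ) / ε₀⌋₊, ((gridVal v (l + 1) - gridVal v l) *
        mean q (fun ω => catTail H ε₀ (G ω) l) + (gridVal v (l + 1) - gridVal v l) * t) := by
        refine Finset.sum_le_sum fun l hl => ?_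
        rw [Finset.mem_range] at hl
        rw [← Finset.mul_sum, mul_div_assoc, ← mul_add]
        exact mul_le_mul_of_nonneg_left (hx ⟨l, hl⟩) (sub_nonneg.2 (gridVal_le_succ hε hv hl))
    _ ≤ _ := by
        rw [Finset.sum_add_distrib, ← Finset.sum_mul, Finset.sum_range_sub, gridVal_zero hv]
        simp only [mean_const_mul]
        gcongr
        rw [sub_zero]
        exact (gridVal_mem_Icc hε hv _).2

end CategoricalProjection

/-! ### Empirical return distributions as linear forms on utilities -/

section ReturnDistributions

variable {S A : Type*} {H : ℕ} {ε₀ : ℝ}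

theorem inner_eq_sum (x v : GridVec H ε₀) : inner ℝ x v = ∑ k, x k * v k := by
  simp [PiLp.inner_apply, mul_comm]

theorem inner_erd (M : MDP S A H) {n : ℕ} (D : Fin n → Traj S A H) (v : GridVec H ε₀) :
    inner ℝ (erd M ε₀ D) v = (∑ j, interp v (cumReward M.r le_rfl (D j).1)) / n := by
  simp only [inner_eq_sum, erd, interp, div_mul_eq_mul_div, Finset.sum_mul]
  rw [← Finset.sum_div, Finset.sum_comm]

theorem inner_etaHat (M : MDP S A H) {K : ℕ} (D : Fin K → Traj S A H) (v : GridVec H ε₀) :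
    inner ℝ (etaHat M ε₀ D) v =
      (∑ j, gridVal v (cumReward (M.rIdx ε₀) le_rfl (D j).1)) / K := by
  simp only [inner_eq_sum, etaHat, div_mul_eq_mul_div, Finset.sum_mul]
  rw [← Finset.sum_div, Finset.sum_comm]
  congr 1
  refine Finset.sum_congr rfl fun j _ => ?_
  set y := cumReward (M.rIdx ε₀) le_rfl (D j).1
  by_cases hy : y < gridCard H ε₀
  · rw [Finset.sum_eq_single ⟨y, hy⟩]
    · simp [gridVal, hy]
    · intro k _ hk
      rw [if_neg fun h => hk (Fin.ext h.symm), zero_mul]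
    · simp
  · rw [gridVal, dif_neg hy]
    refine Finset.sum_eq_zero fun k _ => ?_
    rw [if_neg fun h : y = k => hy (h ▸ k.2), zero_mul]

theorem norm_le_one_of_sum_le_one (x : GridVec H ε₀) (h0 : ∀ k, 0 ≤ x k) (h1 : ∑ k, x k ≤ 1) :
    ‖x‖ ≤ 1 := by
  rw [EuclideanSpace.norm_eq, Real.sqrt_le_one]
  refine (Finset.sum_le_sum fun k _ => ?_).trans h1
  have : x k ≤ 1 := (Finset.single_le_sum (fun k _ => h0 k) (Finset.mem_univ k)).trans h1
  rw [Real.norm_of_nonneg (h0 k), sq]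
  exact mul_le_of_le_one_left (h0 k) this

theorem norm_erd_le_one (hε : 0 < ε₀) (M : MDP S A H) {n : ℕ} (D : Fin n → Traj S A H) :
    ‖erd M ε₀ D‖ ≤ 1 := by
  refine norm_le_one_of_sum_le_one _ (fun k => ?_) ?_
  · exact div_nonneg (Finset.sum_nonneg fun j _ => catProj_nonneg hε _ _) (Nat.cast_nonneg _)
  · simp only [erd]
    rw [← Finset.sum_div, Finset.sum_comm]
    simp only [sum_catProj hε]
    simpa using div_self_le_one (n : ℝ)

theorem norm_etaHat_le_one (M : MDP S A H) {K : ℕ} (D : Fin K → Traj S A H) :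
    ‖etaHat M ε₀ D‖ ≤ 1 := by
  refine norm_le_one_of_sum_le_one _ (fun k => ?_) ?_
  · refine div_nonneg (Finset.sum_nonneg fun j _ => ?_) (Nat.cast_nonneg _)
    split_ifs <;> norm_num
  · simp only [etaHat]
    rw [← Finset.sum_div, Finset.sum_comm]
    refine (div_le_div_of_nonneg_right (Finset.sum_le_sum fun j _ => ?_)
      (Nat.cast_nonneg K)).trans (b := (∑ _j : Fin K, (1 : ℝ)) / K) ?_
    · rw [Fin.sum_univ_eq_sum_range fun k =>
        if cumReward (M.rIdx ε₀) le_rfl (D j).1 = k then (1 : ℝ) else 0, Finset.sum_ite_eq]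
      split_ifs <;> norm_num
    · simpa using div_self_le_one (K : ℝ)

end ReturnDistributions

/-! ### Errors of discretization and of estimation -/

section Errors

variable {S A : Type*} {H : ℕ} {L ε₀ : ℝ}

theorem abs_apply_cumReward_sub_le (hε : 0 < ε₀) (hL : 0 ≤ L) (M : MDP S A H) {U : ℝ → ℝ}
    (hU : U ∈ incUtilLip H L) {v : GridVec H ε₀} (hv : ∀ k, v k = U ((k : ℕ) * ε₀))
    (ω : Fin H → S × A) :
    |U (cumReward M.r le_rfl ω) - gridVal v (cumReward (M.rIdx ε₀) le_rfl ω)| ≤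
      L * (H * ε₀) := by
  have hk := cumReward_rIdx_le M hε ω
  rw [gridVal_eq hv hk]
  refine (hU.2 _ (cumReward_mem_Icc M ω) _
    (gridPoint_mem_Icc hε (Nat.lt_succ_iff.2 hk))).trans ?_
  exact mul_le_mul_of_nonneg_left (abs_cumReward_sub_le M hε ω) hL

variable [Fintype S] [Fintype A]

theorem perf_le_discPerf_add (hε : 0 < ε₀) (hL : 0 ≤ L) (M : MDP S A H) {U : ℝ → ℝ}
    (hU : U ∈ incUtilLip H L) {v : GridVec H ε₀} (hv : ∀ k, v k = U ((k : ℕ) * ε₀))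
    (π : Policy S A H) : perf M U π ≤ discPerf M M.p v π + L * (H * ε₀) := by
  refine mean_le_mean_add _ fun ω => ?_
  have := (abs_le.1 (abs_apply_cumReward_sub_le hε hL M hU hv ω.1)).2
  linarith

theorem discPerf_le_perf_add (hε : 0 < ε₀) (hL : 0 ≤ L) (M : MDP S A H) {U : ℝ → ℝ}
    (hU : U ∈ incUtilLip H L) {v : GridVec H ε₀} (hv : ∀ k, v k = U ((k : ℕ) * ε₀))
    (π : Policy S A H) : discPerf M M.p v π ≤ perf M U π + L * (H * ε₀) := by
  refine mean_le_mean_add (g := fun ω : Traj S A H => U (cumReward M.r le_rfl ω.1)) _ fun ω => ?_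
  have := (abs_le.1 (abs_apply_cumReward_sub_le hε hL M hU hv ω.1)).1
  linarith

/-- The expectation of the grid utility `v` under the categorical projection of the law of the
return of `π`. -/
noncomputable def projPerf (M : MDP S A H) (v : GridVec H ε₀) (π : Policy S A H) : ℝ :=
  mean (trajLaw M.s0 M.p π H le_rfl) fun ω => interp v (cumReward M.r le_rfl ω.1)

theorem projPerf_le_perf_add (hε : 0 < ε₀) (hL : 0 ≤ L) (M : MDP S A H) {U : ℝ → ℝ}
    (hU : U ∈ incUtilLip H L) {v : GridVec H ε₀} (hv : ∀ k, v k = U ((k : ℕ) * ε₀))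
    (π : Policy S A H) : projPerf M v π ≤ perf M U π + L * ε₀ := by
  refine mean_le_mean_add (g := fun ω : Traj S A H => U (cumReward M.r le_rfl ω.1)) _ fun ω => ?_
  have := (abs_le.1 (abs_interp_sub_le hε hL hU hv (cumReward_mem_Icc M ω.1))).2
  linarith

theorem perf_le_projPerf_add (hε : 0 < ε₀) (hL : 0 ≤ L) (M : MDP S A H) {U : ℝ → ℝ}
    (hU : U ∈ incUtilLip H L) {v : GridVec H ε₀} (hv : ∀ k, v k = U ((k : ℕ) * ε₀))
    (π : Policy S A H) : perf M U π ≤ projPerf M v π + L * ε₀ := by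
  refine mean_le_mean_add _ fun ω => ?_
  have := (abs_le.1 (abs_interp_sub_le hε hL hU hv (cumReward_mem_Icc M ω.1))).1
  linarith

/-- The one-step model `p'` gives to no set of states a probability that exceeds by more than `t`
the one given by `p`. -/
def ModelClose (p p' : Fin H → S → A → PMF S) (t : ℝ) : Prop :=
  ∀ h s a (B : Finset S), ∑ s' ∈ B, (p' h s a s').toReal ≤ ∑ s' ∈ B, (p h s a s').toReal + t

theorem discPerf_le_of_modelClose (hε : 0 < ε₀) (M : MDP S A H) {p p' : Fin H → S → A → PMF S}
    {t : ℝ} (hp : ModelClose p p' t) {v : GridVec H ε₀} (hv : v ∈ discUtil H L ε₀)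
    (π : Policy S A H) : discPerf M p v π ≤ discPerf M p' v π + H * (H * t) :=
  mean_trajLaw_le_of_forall M.s0 π (fun h s a _ hV =>
    mean_le_mean_add_of_sum_le' (hp h s a) (Nat.cast_nonneg _) hV) H le_rfl _
    fun _ => gridVal_mem_Icc hε hv _

theorem discPerf_le_of_modelClose' (hε : 0 < ε₀) (M : MDP S A H) {p p' : Fin H → S → A → PMF S}
    {t : ℝ} (hp : ModelClose p p' t) {v : GridVec H ε₀} (hv : v ∈ discUtil H L ε₀)
    (π : Policy S A H) : discPerf M p' v π ≤ discPerf M p v π + H * (H * t) :=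
  mean_trajLaw_le_of_forall M.s0 π (fun h s a _ hV =>
    mean_le_mean_add_of_sum_le (hp h s a) (Nat.cast_nonneg _) hV) H le_rfl _
    fun _ => gridVal_mem_Icc hε hv _

theorem discPerf_add (M : MDP S A H) (p : Fin H → S → A → PMF S) (v w : GridVec H ε₀)
    (π : Policy S A H) : discPerf M p (v + w) π = discPerf M p v π + discPerf M p w π := by
  simp only [discPerf, gridVal_add, mean_add]

theorem discPerf_smul (M : MDP S A H) (p : Fin H → S → A → PMF S) (c : ℝ) (v : GridVec H ε₀)
    (π : Policy S A H) : discPerf M p (c • v) π = c * discPerf M p v π := by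
  simp only [discPerf, gridVal_smul, mean_const_mul]

end Errors

/-! ### Concentration of the data -/

section Concentration

open Classical in
theorem sum_pHat_toReal {S A : Type*} [Fintype S] {H n : ℕ} (hn : 0 < n) (x : GenData S A H n) (h : Fin H) (s : S) (a : A)
    (B : Finset S) : ∑ s' ∈ B, (pHat x h s a s').toReal =
      (∑ j, if x ((h, s, a), j) ∈ B then (1 : ℝ) else 0) / n := by
  have e (q : PMF S) : ∑ s' ∈ B, (q s').toReal = mean q fun s' => if s' ∈ B then 1 else 0 := by
    simp [mean]
  have : Nonempty (Fin n) := ⟨⟨0, hn⟩⟩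
  rw [e, pHat, empirical, dif_pos hn, mean_map, mean]
  rw [Finset.sum_div]
  refine Finset.sum_congr rfl fun j _ => ?_
  rw [PMF.uniformOfFintype_apply, Fintype.card_fin, ENNReal.toReal_inv, ENNReal.toReal_natCast,
    div_eq_inv_mul]

variable {S A : Type*} [Fintype S] [Fintype A] {H : ℕ} {L ε₀ : ℝ}

/-- The expert data `D` estimate well the upper tails of the categorical projection of the return
distribution, and do not underestimate the utility `u` much. -/
def ExpertClose (M : MDP S A H) (π : Policy S A H) (u : GridVec H ε₀) (t : ℝ) {n : ℕ}
    (D : Fin n → Traj S A H) : Prop :=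
  (∀ l : Fin ⌊(H : ℝ) / ε₀⌋₊, (∑ j, catTail H ε₀ (cumReward M.r le_rfl (D j).1) l) / n ≤
    mean (trajLaw M.s0 M.p π H le_rfl)
      (fun ω => catTail H ε₀ (cumReward M.r le_rfl ω.1) l) + t) ∧
  projPerf M u π ≤ inner ℝ (erd M ε₀ D) u + H * t

theorem inner_erd_le_of_expertClose (hε : 0 < ε₀) {M : MDP S A H} {π : Policy S A H}
    {u : GridVec H ε₀} {t : ℝ} (ht : 0 ≤ t) {n : ℕ} {D : Fin n → Traj S A H}
    (hD : ExpertClose M π u t D) {v : GridVec H ε₀} (hv : v ∈ discUtil H L ε₀) :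
    inner ℝ (erd M ε₀ D) v ≤ projPerf M v π + H * t := by
  rw [inner_erd]
  exact average_interp_le _ (fun ω : Traj S A H => cumReward M.r le_rfl ω.1) hε ht D hD.1 hv

theorem toOuterMeasure_not_expertClose_le (hH : 0 < H) (hε : 0 < ε₀) (M : MDP S A H)
    (π : Policy S A H) {u : GridVec H ε₀} (hu : u ∈ discUtil H L ε₀) {t : ℝ} (ht : 0 ≤ t) {n : ℕ}
    (hn : 0 < n) :
    (prodPMF fun _ : Fin n => trajLaw M.s0 M.p π H le_rfl).toOuterMeasure
        {D | ¬ ExpertClose M π u t D} ≤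
      ENNReal.ofReal ((⌊(H : ℝ) / ε₀⌋₊ + 1) * Real.exp (-(2 * n * t ^ 2))) := by
  have hH' : (0 : ℝ) < H := by exact_mod_cast hH
  have h := toOuterMeasure_exists_le (ι := Option (Fin ⌊(H : ℝ) / ε₀⌋₊))
    (prodPMF fun _ : Fin n => trajLaw M.s0 M.p π H le_rfl)
    (fun o => o.elim
      {D | inner ℝ (erd M ε₀ D) u + H * t < projPerf M u π}
      (fun l => {D | mean (trajLaw M.s0 M.p π H le_rfl)
        (fun ω => catTail H ε₀ (cumReward M.r le_rfl ω.1) l) + t <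
        (∑ j, catTail H ε₀ (cumReward M.r le_rfl (D j).1) l) / n}))
    (c := Real.exp (-(2 * n * t ^ 2))) ?_
  · rw [Fintype.card_option, Fintype.card_fin, Nat.cast_add_one] at h
    refine le_trans (MeasureTheory.measure_mono fun D hD => ?_) h
    rw [Set.mem_ofPred_eq, ExpertClose, not_and_or, not_forall, not_le] at hD
    rcases hD with ⟨l, hl⟩ | hD
    · exact ⟨some l, not_le.1 hl⟩
    · exact ⟨none, hD⟩
  · rintro (_ | l)
    · have := hoeffding_average_lower (trajLaw M.s0 M.p π H le_rfl) hn hH'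
        (fun ω => interp_mem_Icc hε hu (cumReward M.r le_rfl ω.1)) (t := H * t)
        (by positivity)
      rw [mul_div_cancel_left₀ _ hH'.ne'] at this
      simp only [Option.elim, inner_erd]
      exact this
    · have := hoeffding_average (trajLaw M.s0 M.p π H le_rfl) hn one_pos
        (fun ω => catTail_mem_Icc (H := H) hε (cumReward M.r le_rfl ω.1) l) ht
      rwa [div_one] at this

theorem toOuterMeasure_not_modelClose_le (M : MDP S A H) {n : ℕ} (hn : 0 < n) {t : ℝ}
    (ht : 0 ≤ t) :
    (genLaw M n).toOuterMeasure {x | ¬ ModelClose M.p (pHat x) t} ≤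
      ENNReal.ofReal (H * Fintype.card S * Fintype.card A * 2 ^ Fintype.card S *
        Real.exp (-(2 * n * t ^ 2))) := by
  classical
  have h := toOuterMeasure_exists_le (ι := (Fin H × S × A) × Finset S) (genLaw M n)
    (fun i => {x | ∑ s' ∈ i.2, (M.p i.1.1 i.1.2.1 i.1.2.2 s').toReal + t <
      ∑ s' ∈ i.2, (pHat x i.1.1 i.1.2.1 i.1.2.2 s').toReal})
    (c := Real.exp (-(2 * n * t ^ 2))) ?_
  · rw [Fintype.card_prod, Fintype.card_prod, Fintype.card_prod, Fintype.card_fin,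
      Fintype.card_finset] at h
    push_cast at h
    rw [← mul_assoc (H : ℝ)] at h
    refine le_trans (MeasureTheory.measure_mono fun x hx => ?_) h
    rw [Set.mem_ofPred_eq, ModelClose] at hx
    push Not at hx
    obtain ⟨h, s, a, B, hB⟩ := hx
    exact ⟨⟨⟨h, s, a⟩, B⟩, hB⟩
  · rintro ⟨⟨h, s, a⟩, B⟩
    have hj := hoeffding
      (fun i : (Fin H × S × A) × Fin n => M.p i.1.1 i.1.2.1 i.1.2.2)
      (Finset.univ.map (Function.Embedding.sectR (h, s, a) (Fin n)))
      (f := fun _ s' => if s' ∈ B then 1 else 0) one_pos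
      (fun _ _ s' => by split_ifs <;> norm_num)
      ⟨_, Finset.mem_map_of_mem _ (Finset.mem_univ ⟨0, hn⟩)⟩ ht
    rw [Finset.card_map, Finset.card_univ, Fintype.card_fin, div_one] at hj
    refine le_trans (MeasureTheory.measure_mono fun x hx => ?_) hj
    rw [Set.mem_ofPred_eq, sum_pHat_toReal hn, lt_div_iff₀ (by positivity)] at hx
    rw [Set.mem_ofPred_eq, Finset.sum_map]
    simp only [Function.Embedding.sectR_apply, Finset.sum_sub_distrib, Finset.sum_const,
      Finset.card_univ, Fintype.card_fin, nsmul_eq_mul]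
    have e : mean (M.p h s a) (fun s' => if s' ∈ B then 1 else 0) =
      ∑ s' ∈ B, (M.p h s a s').toReal := by simp [mean]
    rw [e]
    linarith

/-- The simulated episodes `D` do not underestimate the utility `v` of the policy that is optimal
for `v`, and do not overestimate its utility `u`, by much. -/
def RolloutClose (M : MDP S A H) (sel : (A → ℝ) → A) (p : Fin H → S → A → PMF S)
    (u v : GridVec H ε₀) (t : ℝ) {K : ℕ} (D : Fin K → Traj S A H) : Prop :=
  discPerf M p v (planPolicy M sel p v) ≤ inner ℝ (etaHat M ε₀ D) v + H * t ∧
  inner ℝ (etaHat M ε₀ D) u ≤ discPerf M p u (planPolicy M sel p v) + H * t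

theorem toOuterMeasure_not_rolloutClose_le (hH : 0 < H) (hε : 0 < ε₀) (M : MDP S A H)
    (sel : (A → ℝ) → A) (p : Fin H → S → A → PMF S) {u v : GridVec H ε₀}
    (hu : u ∈ discUtil H L ε₀) (hv : v ∈ discUtil H L ε₀) {t : ℝ} (ht : 0 ≤ t) {K : ℕ}
    (hK : 0 < K) :
    (rolloutLaw M sel p v K).toOuterMeasure {D | ¬ RolloutClose M sel p u v t D} ≤
      ENNReal.ofReal (2 * Real.exp (-(2 * K * t ^ 2))) := by
  have hH' : (0 : ℝ) < H := by exact_mod_cast hH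
  set q := trajLaw M.s0 p (planPolicy M sel p v) H le_rfl
  have h1 := hoeffding_average_lower q hK hH'
    (fun ω => gridVal_mem_Icc hε hv (cumReward (M.rIdx ε₀) le_rfl ω.1)) (t := H * t)
    (by positivity)
  have h2 := hoeffding_average q hK hH'
    (fun ω => gridVal_mem_Icc hε hu (cumReward (M.rIdx ε₀) le_rfl ω.1)) (t := H * t)
    (by positivity)
  rw [mul_div_cancel_left₀ _ hH'.ne'] at h1 h2
  rw [two_mul, ENNReal.ofReal_add (Real.exp_nonneg _) (Real.exp_nonneg _)]
  refine le_trans (MeasureTheory.measure_mono fun D hD => ?_)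
    ((MeasureTheory.measure_union_le _ _).trans (add_le_add h1 h2))
  rw [Set.mem_ofPred_eq, RolloutClose, not_and_or, not_le, not_le, inner_etaHat,
    inner_etaHat] at hD
  exact hD

/-- Union bound over independent environments. -/
theorem toOuterMeasure_prodPMF_exists_le {N : ℕ} {X : Fin N → Type*} [∀ i, Fintype (X i)]
    (q : ∀ i, PMF (X i)) (B : ∀ i, Set (X i)) {c : ℝ}
    (h : ∀ i, (q i).toOuterMeasure (B i) ≤ ENNReal.ofReal c) :
    (prodPMF q).toOuterMeasure {x | ∃ i, x i ∈ B i} ≤ ENNReal.ofReal (N * c) := by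
  have := toOuterMeasure_exists_le (prodPMF q) (fun i => {x | x i ∈ B i}) (c := c)
    fun i => (toOuterMeasure_prodPMF_eval q i (B i)).trans_le (h i)
  rwa [Fintype.card_fin] at this

end Concentration

/-! ### Online learning of the utility -/

section Learning

variable {N H : ℕ} {S A : Fin N → Type*} [∀ i, Fintype (S i)] [∀ i, Fintype (A i)] {L ε₀ : ℝ}

/-- The total advantage, for the grid utility `v` and the dynamics `p`, of the policies `π` over
experts with the return distributions `η`. It is linear in `v`. -/
noncomputable def advantage (M : ∀ i, MDP (S i) (A i) H) (p : ∀ i, Fin H → S i → A i → PMF (S i))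
    (η : Fin N → GridVec H ε₀) (π : ∀ i, Policy (S i) (A i) H) (v : GridVec H ε₀) : ℝ :=
  ∑ i, (discPerf (M i) (p i) v (π i) - inner ℝ (η i) v)

theorem advantage_add (M : ∀ i, MDP (S i) (A i) H) (p : ∀ i, Fin H → S i → A i → PMF (S i))
    (η : Fin N → GridVec H ε₀) (π : ∀ i, Policy (S i) (A i) H) (v w : GridVec H ε₀) :
    advantage M p η π (v + w) = advantage M p η π v + advantage M p η π w := by
  simp only [advantage, ← Finset.sum_add_distrib, discPerf_add, inner_add_right]
  exact Finset.sum_congr rfl fun i _ => by ring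

theorem advantage_smul (M : ∀ i, MDP (S i) (A i) H) (p : ∀ i, Fin H → S i → A i → PMF (S i))
    (η : Fin N → GridVec H ε₀) (π : ∀ i, Policy (S i) (A i) H) (c : ℝ) (v : GridVec H ε₀) :
    advantage M p η π (c • v) = c * advantage M p η π v := by
  simp only [advantage, Finset.mul_sum, discPerf_smul, inner_smul_right, mul_sub]

/-- One iteration: if the simulations are accurate then no policy has a large advantage for the
current utility `v`, up to a telescoping term, since none has for the expert utility `u`. -/
theorem advantage_le_of_rolloutClose (hε : 0 < ε₀) (M : ∀ i, MDP (S i) (A i) H)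
    {sel : ∀ i, (A i → ℝ) → A i} (hsel : ∀ i (f : A i → ℝ) a, f a ≤ f (sel i f))
    (p : ∀ i, Fin H → S i → A i → PMF (S i)) {ηE : Fin N → GridVec H ε₀} (hηE : ∀ i, ‖ηE i‖ ≤ 1)
    {u v : GridVec H ε₀} (hu : u ∈ discUtil H L ε₀) {c t α : ℝ}
    (hα : 0 < α) (hc : ∀ π, advantage M p ηE π u ≤ c) {K : ℕ}
    {D : ∀ i, Fin K → Traj (S i) (A i) H}
    (hD : ∀ i, RolloutClose (M i) (sel i) (p i) u v t (D i)) (π : ∀ i, Policy (S i) (A i) H) :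
    advantage M p ηE π v ≤ c + 2 * (N * (H * t)) + 2 * α * N ^ 2 + (‖v - u‖ ^ 2 -
      ‖euclProj (discUtil H L ε₀) (v - α • ∑ i, (etaHat (M i) ε₀ (D i) - ηE i)) - u‖ ^ 2) /
        (2 * α) := by
  set g := ∑ i, (etaHat (M i) ε₀ (D i) - ηE i) with hg
  have hgn : ‖g‖ ≤ 2 * N := by
    refine (norm_sum_le _ _).trans ((Finset.sum_le_sum fun i _ => (norm_sub_le _ _).trans
      (add_le_add (norm_etaHat_le_one (M i) (D i)) (hηE i))).trans_eq ?_)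
    simp; ring
  have hg2 : ‖g‖ ^ 2 ≤ 4 * N ^ 2 := by nlinarith [norm_nonneg g]
  have h1 : advantage M p ηE π v ≤ inner ℝ g v + N * (H * t) := by
    rw [hg, sum_inner, ← sub_le_iff_le_add', advantage, ← Finset.sum_sub_distrib]
    refine (Finset.sum_le_sum (g := fun _ => H * t) fun i _ => ?_).trans_eq (by simp)
    rw [inner_sub_left]
    have := discPerf_le_discPerf_planPolicy (M i) (hsel i) (p i) v (π i)
    have := (hD i).1
    linarith
  have h2 : inner ℝ g u ≤ c + N * (H * t) := by
    refine le_trans ?_ (add_le_add_left (hc fun i => planPolicy (M i) (sel i) (p i) v) _)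
    rw [hg, sum_inner, ← sub_le_iff_le_add', advantage, ← Finset.sum_sub_distrib]
    refine (Finset.sum_le_sum (g := fun _ => H * t) fun i _ => ?_).trans_eq (by simp)
    rw [inner_sub_left]
    have := (hD i).2
    linarith
  have h3 := inner_le_of_euclProj (isCompact_discUtil hε) convex_discUtil hu v g hα
  rw [inner_sub_right] at h3
  have h4 : α * ‖g‖ ^ 2 / 2 ≤ 2 * α * N ^ 2 := by nlinarith
  linarith

/-- The regret bound satisfied by the sum `x.1` of the first `n` iterates and the next iterate
`x.2`, with a loss of `c` per iteration. -/
def RegretBound (M : ∀ i, MDP (S i) (A i) H) (p : ∀ i, Fin H → S i → A i → PMF (S i))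
    (ηE : Fin N → GridVec H ε₀) (L α c : ℝ) (u v₀ : GridVec H ε₀) (n : ℕ)
    (x : GridVec H ε₀ × GridVec H ε₀) : Prop :=
  x.2 ∈ discUtil H L ε₀ ∧ ∀ π, advantage M p ηE π x.1 ≤
    n * c + (‖v₀ - u‖ ^ 2 - ‖x.2 - u‖ ^ 2) / (2 * α)

/-- Each iteration destroys the regret bound with a probability at most that of an inaccurate simulation
in one of the environments, given the past. -/
theorem toOuterMeasure_tractorLoop_le (hH : 0 < H) (hε : 0 < ε₀) (M : ∀ i, MDP (S i) (A i) H)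
    {sel : ∀ i, (A i → ℝ) → A i} (hsel : ∀ i (f : A i → ℝ) a, f a ≤ f (sel i f))
    (p : ∀ i, Fin H → S i → A i → PMF (S i)) {ηE : Fin N → GridVec H ε₀} (hηE : ∀ i, ‖ηE i‖ ≤ 1)
    {u v₀ : GridVec H ε₀} (hu : u ∈ discUtil H L ε₀) (hv₀ : v₀ ∈ discUtil H L ε₀) {c t α : ℝ}
    (ht : 0 ≤ t) (hα : 0 < α) (hc : ∀ π, advantage M p ηE π u ≤ c) {K : ℕ} (hK : 0 < K) (n : ℕ) :
    (tractorLoop M L ε₀ α K sel p ηE v₀ n).toOuterMeasure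
        {x | RegretBound M p ηE L α (c + 2 * (N * (H * t)) + 2 * α * N ^ 2) u v₀ n x}ᶜ ≤
      ENNReal.ofReal (n * (N * (2 * Real.exp (-(2 * K * t ^ 2))))) := by
  induction n with
  | zero =>
    classical
    rw [tractorLoop, PMF.toOuterMeasure_pure_apply, if_neg]
    · exact bot_le
    · rw [Set.notMem_compl_iff]
      refine ⟨hv₀, fun π => ?_⟩
      have h0 := advantage_smul M p ηE π 0 0
      rw [zero_smul, zero_mul] at h0
      simp [h0]
  | succ n ih =>
    rw [Nat.cast_succ, add_one_mul, tractorLoop]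
    refine toOuterMeasure_bind_le _ _ _ _ (by positivity) (by positivity) ih fun x hx => ?_
    rw [tractorStep, PMF.map_comp, PMF.toOuterMeasure_map_apply]
    refine le_trans (MeasureTheory.measure_mono fun D hD => ?_)
      (toOuterMeasure_prodPMF_exists_le _
        (fun i => {D | ¬ RolloutClose (M i) (sel i) (p i) u x.2 t D}) fun i =>
        toOuterMeasure_not_rolloutClose_le hH hε (M i) (sel i) (p i) hu hx.1 ht hK)
    by_contra hD'
    simp only [Set.mem_ofPred_eq, not_exists, not_not] at hD'
    refine hD ⟨(euclProj_spec (isCompact_discUtil hε) ⟨u, hu⟩ _).1, fun π => ?_⟩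
    have h1 := advantage_le_of_rolloutClose hε M hsel p hηE hu hα hc hD' π
    have h2 := hx.2 π
    simp only [Function.comp, advantage_add]
    push_cast
    refine (add_le_add h2 h1).trans_eq ?_
    ring

theorem sum_nonCompat_le (M : ∀ i, MDP (S i) (A i) H) (πE : ∀ i, Policy (S i) (A i) H)
    {U : ℝ → ℝ} {b : ℝ}
    (h : ∀ π : ∀ i, Policy (S i) (A i) H, ∑ i, (perf (M i) U (π i) - perf (M i) U (πE i)) ≤ b) :
    ∑ i, nonCompat (M i) (πE i) U ≤ b := by
  have hmax (i : Fin N) : ∃ π, ∀ π', perf (M i) U π' ≤ perf (M i) U π := by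
    have : Nonempty (Policy (S i) (A i) H) := ⟨πE i⟩
    exact Finite.exists_max _
  choose π hπ using hmax
  refine (Finset.sum_le_sum fun i _ => ?_).trans (h π)
  have : Nonempty (Policy (S i) (A i) H) := ⟨πE i⟩
  exact sub_le_sub_right (ciSup_le (hπ i)) _

/-- As the experts are optimal for the utility `UE`, no policy has a large estimated advantage for
it. -/
theorem advantage_gridRestrict_le {M : ∀ i, MDP (S i) (A i) H} {πE : ∀ i, Policy (S i) (A i) H} (hε : 0 < ε₀)
    (hL : 0 ≤ L) {UE : ℝ → ℝ} (hUE : UE ∈ incUtilLip H L)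
    (hopt : ∀ i π, perf (M i) UE π ≤ perf (M i) UE (πE i))
    {p : ∀ i, Fin H → S i → A i → PMF (S i)} {t₁ t₂ : ℝ}
    (hp : ∀ i, ModelClose (M i).p (p i) t₁) {n : Fin N → ℕ}
    {DE : ∀ i, Fin (n i) → Traj (S i) (A i) H}
    (hDE : ∀ i, ExpertClose (M i) (πE i) (gridRestrict H ε₀ UE) t₂ (DE i))
    (π : ∀ i, Policy (S i) (A i) H) :
    advantage M p (fun i => erd (M i) ε₀ (DE i)) π (gridRestrict H ε₀ UE) ≤
      N * (L * (H * ε₀) + H * (H * t₁) + (L * ε₀ + H * t₂)) := by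
  refine (Finset.sum_le_sum fun i _ => ?_).trans_eq
    (by rw [Finset.sum_const, Finset.card_univ, Fintype.card_fin, nsmul_eq_mul])
  have h1 := discPerf_le_of_modelClose' hε (M i) (hp i) (gridRestrict_mem_discUtil hUE) (π i)
  have h2 := discPerf_le_perf_add (v := gridRestrict H ε₀ UE) hε hL (M i) hUE (fun _ => rfl) (π i)
  have h3 := hopt i (π i)
  have h4 := perf_le_projPerf_add (v := gridRestrict H ε₀ UE) hε hL (M i) hUE (fun _ => rfl) (πE i)
  have h5 := (hDE i).2
  linarith

/-- A utility for which no policy has a large estimated advantage over the expert demonstrations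
is nearly compatible with the experts. -/
theorem sum_nonCompat_le_of_advantage_le {M : ∀ i, MDP (S i) (A i) H}
    {πE : ∀ i, Policy (S i) (A i) H} (hε : 0 < ε₀) (hL : 0 ≤ L) {U : ℝ → ℝ}
    (hU : U ∈ incUtilLip H L) {v : GridVec H ε₀} (hv : ∀ k, v k = U ((k : ℕ) * ε₀))
    {p : ∀ i, Fin H → S i → A i → PMF (S i)} {t₁ t₂ : ℝ} (ht₂ : 0 ≤ t₂)
    (hp : ∀ i, ModelClose (M i).p (p i) t₁) {n : Fin N → ℕ}
    {DE : ∀ i, Fin (n i) → Traj (S i) (A i) H} {u : GridVec H ε₀}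
    (hDE : ∀ i, ExpertClose (M i) (πE i) u t₂ (DE i)) {b : ℝ}
    (hb : ∀ π, advantage M p (fun i => erd (M i) ε₀ (DE i)) π v ≤ b) :
    ∑ i, nonCompat (M i) (πE i) U ≤
      b + N * (L * (H * ε₀) + H * (H * t₁) + (L * ε₀ + H * t₂)) := by
  refine sum_nonCompat_le M πE fun π => ?_
  refine le_trans ?_ (add_le_add_left (hb π) _)
  rw [← sub_le_iff_le_add', advantage, ← Finset.sum_sub_distrib]
  refine (Finset.sum_le_sum fun i _ => ?_).trans_eq
    (by rw [Finset.sum_const, Finset.card_univ, Fintype.card_fin, nsmul_eq_mul])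
  have hv' : v ∈ discUtil H L ε₀ := ⟨U, hU, hv⟩
  have h1 := perf_le_discPerf_add hε hL (M i) hU hv (π i)
  have h2 := discPerf_le_of_modelClose hε (M i) (hp i) hv' (π i)
  have h3 := projPerf_le_perf_add hε hL (M i) hU hv (πE i)
  have h4 := inner_erd_le_of_expertClose hε ht₂ (hDE i) hv'
  linarith

/-- The guarantee of the algorithm with its three sources of randomness and its optimization error
kept apart. -/
theorem ofReal_le_toOuterMeasure_tractor (hH : 0 < H) (hε : 0 < ε₀) (hL : 0 ≤ L)
    (M : ∀ i, MDP (S i) (A i) H) (πE : ∀ i, Policy (S i) (A i) H) {UE : ℝ → ℝ}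
    (hUE : UE ∈ incUtilLip H L) (hopt : ∀ i π, perf (M i) UE π ≤ perf (M i) UE (πE i))
    {τE τ : Fin N → ℕ} (hτE : ∀ i, 0 < τE i)
    (hτ : ∀ i, 0 < samplesPerTriple (S i) (A i) H (τ i)) {K T : ℕ} (hK : 0 < K) (hT : 0 < T)
    {α : ℝ} (hα : 0 < α) {v₀ : GridVec H ε₀} (hv₀ : v₀ ∈ discUtil H L ε₀)
    {sel : ∀ i, (A i → ℝ) → A i} (hsel : ∀ i (f : A i → ℝ) a, f a ≤ f (sel i f))
    {t₁ t₂ t₃ a b ε δ : ℝ} (ht₁ : 0 ≤ t₁) (ht₂ : 0 ≤ t₂) (ht₃ : 0 ≤ t₃) (ha : 0 ≤ a) (hb : 0 ≤ b)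
    (hprobE : ∀ i, (⌊(H : ℝ) / ε₀⌋₊ + 1) * Real.exp (-(2 * τE i * t₂ ^ 2)) ≤ a)
    (hprob : ∀ i, H * Fintype.card (S i) * Fintype.card (A i) * 2 ^ Fintype.card (S i) *
      Real.exp (-(2 * (samplesPerTriple (S i) (A i) H (τ i) : ℕ) * t₁ ^ 2)) ≤ b)
    (hδ : N * a + (N * b + T * (N * (2 * Real.exp (-(2 * K * t₃ ^ 2))))) ≤ δ)
    (herr : 2 * (N * (L * (H * ε₀) + H * (H * t₁) + (L * ε₀ + H * t₂))) + 2 * (N * (H * t₃)) +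
      2 * α * N ^ 2 + ‖v₀ - gridRestrict H ε₀ UE‖ ^ 2 / (2 * α * T) ≤ ε) :
    ENNReal.ofReal (1 - δ) ≤ (tractor M πE τE τ L ε₀ α K T sel v₀).toOuterMeasure
      {Uhat | ∀ U ∈ incUtilLip H L, (∀ j : Fin (gridCard H ε₀), U ((j : ℕ) * ε₀) = Uhat j) →
        U ∈ relaxedFeasible M πE ε} := by
  classical
  have hu := gridRestrict_mem_discUtil (ε₀ := ε₀) hUE
  refine le_trans (ENNReal.ofReal_le_ofReal (sub_le_sub_left hδ 1))
    (ofReal_one_sub_le_toOuterMeasure _ _ (by positivity) ?_)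
  refine toOuterMeasure_bind_le _ _
    {DE | ∀ i, ExpertClose (M i) (πE i) (gridRestrict H ε₀ UE) t₂ (DE i)} _ (by positivity)
    (by positivity) ?_ fun DE hDE => ?_
  · refine le_trans (MeasureTheory.measure_mono fun DE hDE => ?_)
      (toOuterMeasure_prodPMF_exists_le _
        (fun i => {D | ¬ ExpertClose (M i) (πE i) (gridRestrict H ε₀ UE) t₂ D}) fun i =>
        (toOuterMeasure_not_expertClose_le hH hε (M i) (πE i) hu ht₂ (hτE i)).trans
          (ENNReal.ofReal_le_ofReal (hprobE i)))
    exact not_forall.1 hDE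
  refine toOuterMeasure_bind_le _ _ {X | ∀ i, ModelClose (M i).p (pHat (X i)) t₁} _
    (by positivity) (by positivity) ?_ fun X hX => ?_
  · refine le_trans (MeasureTheory.measure_mono fun X hX => ?_)
      (toOuterMeasure_prodPMF_exists_le _ (fun i => {x | ¬ ModelClose (M i).p (pHat x) t₁})
        fun i => (toOuterMeasure_not_modelClose_le (M i) (hτ i) ht₁).trans
          (ENNReal.ofReal_le_ofReal (hprob i)))
    exact not_forall.1 hX
  rw [PMF.toOuterMeasure_map_apply]
  refine le_trans (MeasureTheory.measure_mono ?_)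
    (toOuterMeasure_tractorLoop_le hH hε M hsel (fun i => pHat (X i))
      (fun i => norm_erd_le_one hε (M i) (DE i)) hu hv₀ ht₃ hα
      (advantage_gridRestrict_le hε hL hUE hopt hX hDE) hK T)
  rw [Set.preimage_compl, Set.compl_subset_compl]
  intro x hx U hU hUx
  have hT' : (0 : ℝ) < T := by exact_mod_cast hT
  refine ⟨hU.1, (sum_nonCompat_le_of_advantage_le hε hL hU (fun k => (hUx k).symm) ht₂ hX hDE
    (b := N * (L * (H * ε₀) + H * (H * t₁) + (L * ε₀ + H * t₂)) + 2 * (N * (H * t₃)) +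
      2 * α * N ^ 2 + ‖v₀ - gridRestrict H ε₀ UE‖ ^ 2 / (2 * α * T))
    fun π => ?_).trans (le_trans (by linarith) herr)⟩
  rw [advantage_smul, one_div_mul_eq_div, div_le_iff₀ hT']
  refine (hx.2 π).trans ?_
  rw [add_mul, mul_comm (T : ℝ), div_mul_eq_div_div _ (2 * α) (T : ℝ), div_mul_cancel₀ _ hT'.ne', sub_div]
  have : 0 ≤ ‖x.2 - gridRestrict H ε₀ UE‖ ^ 2 / (2 * α) := by positivity
  linarith

end Learning

/-! ### Choice of the parameters -/

section Parameters

theorem norm_sub_sq_le_of_mem_discUtil {H : ℕ} {L ε₀ : ℝ} (hε : 0 < ε₀) {v u : GridVec H ε₀}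
    (hv : v ∈ discUtil H L ε₀) (hu : u ∈ discUtil H L ε₀) :
    ‖v - u‖ ^ 2 ≤ (⌊(H : ℝ) / ε₀⌋₊ + 1) * (H : ℝ) ^ 2 := by
  rw [EuclideanSpace.norm_sq_eq]
  refine (Finset.sum_le_sum (g := fun _ => (H : ℝ) ^ 2) fun k _ => ?_).trans_eq (by simp)
  have h1 := gridVal_mem_Icc hε hv k
  have h2 := gridVal_mem_Icc hε hu k
  rw [gridVal_coe] at h1 h2
  rw [Real.norm_eq_abs, PiLp.sub_apply]
  refine pow_le_pow_left₀ (abs_nonneg _) (abs_le.2 ⟨?_, ?_⟩) 2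
  · linarith [h1.1, h2.2]
  · linarith [h1.2, h2.1]

/-- The number of expert trajectories makes the failure probability of the expert data, a union bound
over the `m + 1` grid points, at most `δ / (4 * N)` per environment. The lower bound on the argument
of the logarithm absorbs the numerical constants. -/
theorem expert_tail_le {N H L ε δ m x : ℝ} (hN : 1 ≤ N) (hH : 1 ≤ H) (hL : 1 ≤ L)
    (hε : ε ∈ Set.Ioo (0 : ℝ) 1) (hδ : δ ∈ Set.Ioo (0 : ℝ) 1)
    (hQ : 5 / 4 ≤ H * N * L / (δ * ε)) (hm : m ≤ 80 * N ^ 2 * L ^ 2 * H ^ 2 / ε ^ 2)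
    (hx : 10 ^ 5 * (N ^ 4 * H ^ 4 * L ^ 2 / ε ^ 4 * Real.log (H * N * L / (δ * ε))) ≤ x) :
    (m + 1) * Real.exp (-(2 * x * (ε / (10 * N * H)) ^ 2)) ≤ δ / (4 * N) := by
  obtain ⟨hε0, hε1⟩ := hε
  obtain ⟨hδ0, hδ1⟩ := hδ
  set Q := H * N * L / (δ * ε) with hQdef
  have hy : 0 ≤ Real.log Q := Real.log_nonneg (by linarith)
  have hE : 30 * Real.log Q ≤ 2 * x * (ε / (10 * N * H)) ^ 2 := by
    have h1 : 1 ≤ N ^ 2 * H ^ 2 * L ^ 2 / ε ^ 2 := by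
      rw [one_le_div (by positivity), ← mul_pow, ← mul_pow]
      exact pow_le_pow_left₀ hε0.le (hε1.le.trans (one_le_mul_of_one_le_of_one_le
        (one_le_mul_of_one_le_of_one_le hN hH) hL)) 2
    calc 30 * Real.log Q ≤ 2000 * (N ^ 2 * H ^ 2 * L ^ 2 / ε ^ 2) * Real.log Q := by
          gcongr; linarith
      _ = 2 * (10 ^ 5 * (N ^ 4 * H ^ 4 * L ^ 2 / ε ^ 4 * Real.log Q)) *
          (ε / (10 * N * H)) ^ 2 := by field_simp; norm_num; ring
      _ ≤ _ := by gcongr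
  have hexp : Q ^ 30 ≤ Real.exp (2 * x * (ε / (10 * N * H)) ^ 2) := by
    refine le_trans (le_of_eq ?_) (Real.exp_le_exp.2 hE)
    rw [show 30 * Real.log Q = ((30 : ℕ) : ℝ) * Real.log Q by norm_num, Real.exp_nat_mul,
      Real.exp_log (by linarith)]
  -- `324 = 4 * 81`, where `81 * (N * L * H / ε) ^ 2` bounds the number of grid points
  have hQ30 : 324 * Q ^ 3 ≤ Q ^ 30 := by
    have h1 : (324 : ℝ) ≤ Q ^ 27 := le_trans (by norm_num) (pow_le_pow_left₀ (by norm_num) hQ 27)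
    calc 324 * Q ^ 3 ≤ Q ^ 27 * Q ^ 3 := by gcongr
      _ = Q ^ 30 := by ring
  have hm1 : m + 1 ≤ 81 * N ^ 2 * L ^ 2 * H ^ 2 / ε ^ 2 := by
    have h1 : 1 ≤ N ^ 2 * L ^ 2 * H ^ 2 / ε ^ 2 := by
      rw [one_le_div (by positivity), ← mul_pow, ← mul_pow]
      exact pow_le_pow_left₀ hε0.le (hε1.le.trans (one_le_mul_of_one_le_of_one_le
        (one_le_mul_of_one_le_of_one_le hN hL) hH)) 2
    have e (c : ℝ) : c * N ^ 2 * L ^ 2 * H ^ 2 / ε ^ 2 = c * (N ^ 2 * L ^ 2 * H ^ 2 / ε ^ 2) := by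
      ring
    rw [e] at hm ⊢
    linarith
  have hkey : (m + 1) * (4 * N) ≤ δ * (324 * Q ^ 3) := by
    calc (m + 1) * (4 * N) ≤ 81 * N ^ 2 * L ^ 2 * H ^ 2 / ε ^ 2 * (4 * N) := by gcongr
      _ = 324 * (N ^ 3 * L ^ 2 * H ^ 2 / ε ^ 2) := by ring
      _ ≤ 324 * (N ^ 3 * L ^ 2 * H ^ 2 / ε ^ 2 * (L * H / (ε * δ ^ 2))) := by
          gcongr
          refine le_mul_of_one_le_right (by positivity) ?_
          rw [one_le_div (by positivity)]
          exact (mul_le_one₀ hε1.le (by positivity) (pow_le_one₀ hδ0.le hδ1.le)).trans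
            (one_le_mul_of_one_le_of_one_le hL hH)
      _ = δ * (324 * Q ^ 3) := by rw [hQdef]; field_simp
  rw [Real.exp_neg, ← div_eq_mul_inv, div_le_div_iff₀ (Real.exp_pos _) (by positivity)]
  exact hkey.trans (mul_le_mul_of_nonneg_left (hQ30.trans hexp) hδ0.le)

/-- Rounding down a number of samples per triple that is at least `2` loses at most a factor `2`. -/
theorem le_floor_div_of_le {W c : ℝ} (hW : 1 ≤ W) {τ k : ℕ} (hk : 0 < k) (hc : (k : ℝ) = c)
    (h : 2 * W * c ≤ τ) : W ≤ (τ / k : ℕ) := by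
  have h1 : (τ : ℝ) < ((τ / k : ℕ) + 1) * k := by
    rw [mul_comm]
    exact_mod_cast Nat.lt_mul_div_succ τ hk
  rw [← hc] at h
  have h2 := lt_of_mul_lt_mul_right (h.trans_lt h1) (Nat.cast_nonneg k)
  linarith

/-- The number `n` of samples per triple makes the failure probability of the estimated model at most
`δ / (4 * N)` per environment. -/
theorem model_tail_le {N H A ε δ n : ℝ} {S : ℕ} (hN : 1 ≤ N) (hH : 1 ≤ H) (hS : 1 ≤ S)
    (hA : 1 ≤ A) (hε : ε ∈ Set.Ioo (0 : ℝ) 1) (hδ : δ ∈ Set.Ioo (0 : ℝ) 1)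
    (hn : 5 * 10 ^ 4 * (N ^ 2 * H ^ 4 / ε ^ 2 * (S + Real.log (S * A * H * N / δ))) ≤ n) :
    H * S * A * 2 ^ S * Real.exp (-(2 * n * (ε / (10 * N * H ^ 2)) ^ 2)) ≤ δ / (4 * N) := by
  obtain ⟨hε0, hε1⟩ := hε
  obtain ⟨hδ0, hδ1⟩ := hδ
  have hS' : (1 : ℝ) ≤ S := by exact_mod_cast hS
  set Q := S * A * H * N / δ with hQ
  have hQ0 : 0 < Q := by positivity
  have hQ1 : 1 ≤ Q := by
    rw [hQ, one_le_div hδ0]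
    exact hδ1.le.trans (one_le_mul_of_one_le_of_one_le (one_le_mul_of_one_le_of_one_le
      (one_le_mul_of_one_le_of_one_le hS' hA) hH) hN)
  have hy : 0 ≤ Real.log Q := Real.log_nonneg hQ1
  have hE : 3 * S + Real.log Q ≤ 2 * n * (ε / (10 * N * H ^ 2)) ^ 2 := by
    calc 3 * S + Real.log Q ≤ 1000 * (S + Real.log Q) := by linarith
      _ = 2 * (5 * 10 ^ 4 * (N ^ 2 * H ^ 4 / ε ^ 2 * (S + Real.log Q))) *
          (ε / (10 * N * H ^ 2)) ^ 2 := by field_simp; norm_num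
      _ ≤ _ := by gcongr
  have hexp : 4 * 2 ^ S * Q ≤ Real.exp (2 * n * (ε / (10 * N * H ^ 2)) ^ 2) := by
    refine le_trans ?_ (Real.exp_le_exp.2 hE)
    rw [Real.exp_add, Real.exp_log hQ0]
    gcongr
    have h2 : (2 : ℝ) ≤ Real.exp 1 := by linarith [Real.add_one_le_exp (1 : ℝ)]
    calc (4 : ℝ) * 2 ^ S = 2 ^ (2 + S) := by rw [pow_add]; norm_num
      _ ≤ 2 ^ (3 * S) := pow_le_pow_right₀ (by norm_num) (by omega)
      _ ≤ Real.exp 1 ^ (3 * S) := pow_le_pow_left₀ (by norm_num) h2 _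
      _ = Real.exp (3 * S) := by rw [← Real.exp_nat_mul]; push_cast; rw [mul_one]
  rw [Real.exp_neg, ← div_eq_mul_inv, div_le_div_iff₀ (Real.exp_pos _) (by positivity)]
  refine le_trans (le_of_eq ?_) (mul_le_mul_of_nonneg_left hexp hδ0.le)
  rw [hQ]
  field_simp

/-- The number of simulated episodes makes their total failure probability, over all iterations and
environments, at most `δ / 4`. -/
theorem rollout_tail_le {N H T K ε δ : ℝ} (hN : 1 ≤ N) (hH : 1 ≤ H) (hT : 10 ^ 5 ≤ T)
    (hε : ε ∈ Set.Ioo (0 : ℝ) 1) (hδ : δ ∈ Set.Ioo (0 : ℝ) 1)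
    (hK : 10 ^ 5 * (N ^ 2 * H ^ 2 / ε ^ 2 * Real.log (N * T / δ)) ≤ K) :
    T * (N * (2 * Real.exp (-(2 * K * (ε / (10 * N * H)) ^ 2)))) ≤ δ / 4 := by
  obtain ⟨hε0, hε1⟩ := hε
  obtain ⟨hδ0, hδ1⟩ := hδ
  set Q := N * T / δ with hQ
  have hT0 : 0 < T := by linarith
  have hQ0 : 0 < Q := by positivity
  have hQ1 : 8 ≤ Q := by
    rw [hQ, le_div_iff₀ hδ0]
    nlinarith
  have hy : 0 ≤ Real.log Q := Real.log_nonneg (by linarith)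
  have hE : (2 : ℕ) * Real.log Q ≤ 2 * K * (ε / (10 * N * H)) ^ 2 := by
    calc (2 : ℕ) * Real.log Q ≤ 2000 * Real.log Q := by push_cast; linarith
      _ = 2 * (10 ^ 5 * (N ^ 2 * H ^ 2 / ε ^ 2 * Real.log Q)) *
          (ε / (10 * N * H)) ^ 2 := by field_simp; norm_num; ring
      _ ≤ _ := by gcongr
  have hexp : 8 * Q ≤ Real.exp (2 * K * (ε / (10 * N * H)) ^ 2) := by
    refine le_trans ?_ (Real.exp_le_exp.2 hE)
    rw [Real.exp_nat_mul, Real.exp_log hQ0, sq]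
    gcongr
  rw [Real.exp_neg, ← mul_assoc, ← mul_assoc, ← div_eq_mul_inv,
    div_le_div_iff₀ (Real.exp_pos _) (by positivity)]
  refine le_trans (le_of_eq ?_) (mul_le_mul_of_nonneg_left hexp hδ0.le)
  rw [hQ]
  field_simp
  norm_num

/-- The regret of projected subgradient descent, averaged over the iterations, for the squared distance
`D` to the initial point. -/
theorem optimization_error_le {N H L T ε m D α : ℝ} (hN : 1 ≤ N) (hH : 1 ≤ H) (hL : 1 ≤ L)
    (hε : ε ∈ Set.Ioo (0 : ℝ) 1) (hT : 10 ^ 5 * (N ^ 4 * H ^ 4 * L ^ 2 / ε ^ 4) ≤ T)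
    (hm3 : 3 ≤ m) (hm : m ≤ 80 * N ^ 2 * L ^ 2 * H ^ 2 / ε ^ 2) (hD : D ≤ (m + 1) * H ^ 2)
    (hα : α = H * Real.sqrt (m - 1) / (2 * N * Real.sqrt T)) :
    2 * α * N ^ 2 + D / (2 * α * T) ≤ ε / 10 := by
  obtain ⟨hε0, hε1⟩ := hε
  have hT0 : 0 < T := lt_of_lt_of_le (by positivity) hT
  have hr : 0 < Real.sqrt (m - 1) := Real.sqrt_pos.2 (by linarith)
  have hq : 0 < Real.sqrt T := Real.sqrt_pos.2 hT0
  have hr2 : Real.sqrt (m - 1) ^ 2 = m - 1 := Real.sq_sqrt (by linarith)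
  have hq2 : Real.sqrt T ^ 2 = T := Real.sq_sqrt hT0.le
  have hr3 : Real.sqrt (m - 1) ≤ 9 * N * L * H / ε := by
    refine Real.sqrt_le_iff.2 ⟨by positivity, ?_⟩
    calc m - 1 ≤ 80 * N ^ 2 * L ^ 2 * H ^ 2 / ε ^ 2 := by linarith
      _ ≤ 81 * N ^ 2 * L ^ 2 * H ^ 2 / ε ^ 2 := by gcongr; norm_num
      _ = _ := by field_simp; norm_num
  have hq3 : 270 * N ^ 2 * H ^ 2 * L / ε ^ 2 ≤ Real.sqrt T := by
    refine Real.le_sqrt_of_sq_le (le_trans ?_ hT)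
    calc (270 * N ^ 2 * H ^ 2 * L / ε ^ 2) ^ 2
        = 72900 * (N ^ 4 * H ^ 4 * L ^ 2 / ε ^ 4) := by field_simp; norm_num
      _ ≤ _ := by gcongr; norm_num
  set r := Real.sqrt (m - 1)
  set q := Real.sqrt T
  have hD' : D ≤ 2 * r ^ 2 * H ^ 2 := hD.trans (by rw [hr2]; gcongr; linarith)
  have hα0 : 0 < α := by rw [hα]; positivity
  calc 2 * α * N ^ 2 + D / (2 * α * T)
      ≤ 2 * α * N ^ 2 + 2 * r ^ 2 * H ^ 2 / (2 * α * q ^ 2) := by rw [hq2]; gcongr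
    _ = 3 * N * H * r / q := by rw [hα]; field_simp; ring
    _ ≤ 3 * N * H * (9 * N * L * H / ε) / (270 * N ^ 2 * H ^ 2 * L / ε ^ 2) := by gcongr
    _ = ε / 10 := by field_simp; norm_num

theorem total_error_le {N H L ε ε₀ r : ℝ} (hN : 1 ≤ N) (hH : 1 ≤ H) (hL : 1 ≤ L)
    (hε : ε ∈ Set.Ioo (0 : ℝ) 1) (hε₀ : ε₀ = ε ^ 2 / (80 * N ^ 2 * L ^ 2 * H))
    (hr : r ≤ ε / 10) :
    2 * (N * (L * (H * ε₀) + H * (H * (ε / (10 * N * H ^ 2))) +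
      (L * ε₀ + H * (ε / (10 * N * H))))) + 2 * (N * (H * (ε / (10 * N * H)))) + r ≤ ε := by
  obtain ⟨hε0, hε1⟩ := hε
  have h1 : N * (L * (H * ε₀)) ≤ ε / 80 := by
    have e : N * (L * (H * ε₀)) = ε / 80 * (ε / (N * L)) := by rw [hε₀]; field_simp
    rw [e]
    refine mul_le_of_le_one_right (by positivity) ?_
    rw [div_le_one (by positivity)]
    exact hε1.le.trans (one_le_mul_of_one_le_of_one_le hN hL)
  have h2 : N * (L * ε₀) ≤ N * (L * (H * ε₀)) := by
    have : 0 ≤ ε₀ := by rw [hε₀]; positivity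
    gcongr
    exact le_mul_of_one_le_left this hH
  have h3 : N * (H * (H * (ε / (10 * N * H ^ 2)))) = ε / 10 := by field_simp
  have h4 : N * (H * (ε / (10 * N * H))) = ε / 10 := by field_simp
  linarith

end Parameters

/-! ### Nearly degenerate classes of utilities -/

section Degenerate

variable {N H : ℕ} {S A : Fin N → Type*} [∀ i, Fintype (S i)] [∀ i, Fintype (A i)] {L : ℝ}

theorem le_add_of_mem_incUtilLip {U V : ℝ → ℝ} (hU : U ∈ incUtilLip H L)
    (hV : V ∈ incUtilLip H L) {x : ℝ} (hx : x ∈ Set.Icc (0 : ℝ) H) : U x ≤ V x + (L - 1) * H := by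
  have h1 := hU.2 x hx 0 ⟨le_rfl, Nat.cast_nonneg _⟩
  have h2 := hV.2 H ⟨Nat.cast_nonneg _, le_rfl⟩ x hx
  rw [hU.1.2.1, sub_zero, sub_zero, abs_of_nonneg hx.1] at h1
  rw [hV.1.2.2.1, abs_of_nonneg (sub_nonneg.2 hx.2)] at h2
  have h3 := (abs_le.1 h1).2
  have h4 := (abs_le.1 h2).2
  linarith

/-- All `L`-Lipschitz utilities are close to each other when `L` is close to `1`. -/
theorem sum_nonCompat_le_of_lipschitz (M : ∀ i, MDP (S i) (A i) H)
    {πE : ∀ i, Policy (S i) (A i) H} {UE U : ℝ → ℝ} (hUE : UE ∈ incUtilLip H L)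
    (hU : U ∈ incUtilLip H L) (hopt : ∀ i π, perf (M i) UE π ≤ perf (M i) UE (πE i)) :
    ∑ i, nonCompat (M i) (πE i) U ≤ N * (2 * ((L - 1) * H)) := by
  refine sum_nonCompat_le M πE fun π => ?_
  refine (Finset.sum_le_sum fun i _ => ?_).trans_eq
    (by rw [Finset.sum_const, Finset.card_univ, Fintype.card_fin, nsmul_eq_mul])
  have h (i : Fin N) (π : Policy (S i) (A i) H) {U V : ℝ → ℝ} (hU : U ∈ incUtilLip H L)
      (hV : V ∈ incUtilLip H L) : perf (M i) U π ≤ perf (M i) V π + (L - 1) * H :=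
    mean_le_mean_add (g := fun ω : Traj (S i) (A i) H => V (cumReward (M i).r le_rfl ω.1)) _
      fun ω => le_add_of_mem_incUtilLip hU hV (cumReward_mem_Icc (M i) ω.1)
  have h1 := h i (π i) hU hUE
  have h2 := h i (πE i) hUE hU
  have h3 := hopt i (π i)
  linarith

/-- The logarithmic factor of the bound on the number of expert trajectories is bounded away from
zero, unless the class of utilities is so small that all its members are compatible with the
experts up to `ε`. -/
theorem degenerate_error_le {L ε δ : ℝ} (hN : 0 < N) (hH : 0 < H) (hL : 1 ≤ L)
    (hε : ε ∈ Set.Ioo (0 : ℝ) 1) (hδ : δ ∈ Set.Ioo (0 : ℝ) 1)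
    (hQ : H * N * L / (δ * ε) < 5 / 4) : N * (2 * ((L - 1) * H)) ≤ ε := by
  obtain ⟨hε0, hε1⟩ := hε
  obtain ⟨hδ0, hδ1⟩ := hδ
  rw [div_lt_iff₀ (by positivity)] at hQ
  have h1 : (H : ℝ) * N < 2 := by
    have h1 : (H : ℝ) * N ≤ H * N * L := le_mul_of_one_le_right (by positivity) hL
    nlinarith
  have h2 : H * N < 2 := by exact_mod_cast h1
  obtain ⟨rfl, rfl⟩ : H = 1 ∧ N = 1 := mul_eq_one.1 (by
    have := Nat.mul_pos hH hN
    omega)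
  norm_num at hQ ⊢
  nlinarith

end Degenerate

end UL

theorem mainTheorem2 :
    ∃ (C : ℝ) (k : ℕ), 0 < C ∧
      ∀ (N H : ℕ) (_ : 0 < N) (_ : 0 < H)
        (S A : Fin N → Type*) [∀ i, Fintype (S i)] [∀ i, Fintype (A i)]
        (M : ∀ i, UL.MDP (S i) (A i) H) (πE : ∀ i, UL.Policy (S i) (A i) H)
        (L ε δ : ℝ) (_ : 0 < L) (_ : ε ∈ Set.Ioo (0 : ℝ) 1) (_ : δ ∈ Set.Ioo (0 : ℝ) 1)
        -- the expert: the policies are optimal for a common utility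
        (UE : ℝ → ℝ) (_ : UE ∈ UL.incUtilLip H L)
        (_ : ∀ i π, UL.perf (M i) UE π ≤ UL.perf (M i) UE (πE i))
        -- the sample sizes
        (τE τ : Fin N → ℕ)
        (_ : ∀ i, UL.softO C k
            ((N : ℝ) ^ 4 * (H : ℝ) ^ 4 * L ^ 2 / ε ^ 4 * Real.log (H * N * L / (δ * ε)))
          ≤ τE i)
        (_ : ∀ i, UL.softO C k
            ((N : ℝ) ^ 2 * Fintype.card (S i) * Fintype.card (A i) * (H : ℝ) ^ 5 / ε ^ 2 *
              (Fintype.card (S i) +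
                Real.log (Fintype.card (S i) * Fintype.card (A i) * H * N / δ)))
          ≤ τ i)
        -- the number of iterations and the parameters of the algorithm
        (T : ℕ) (_ : C * ((N : ℝ) ^ 4 * (H : ℝ) ^ 4 * L ^ 2 / ε ^ 4) ≤ T)
        (K : ℕ) (_ : UL.softO C k ((N : ℝ) ^ 2 * (H : ℝ) ^ 2 / ε ^ 2 * Real.log (N * T / δ)) ≤ K)
        (ε₀ : ℝ) (_ : ε₀ = ε ^ 2 / (80 * (N : ℝ) ^ 2 * L ^ 2 * H))
        (α : ℝ) (_ : α = H * Real.sqrt ((⌊(H : ℝ) / ε₀⌋₊ : ℝ) - 1) / (2 * N * Real.sqrt T))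
        (v₀ : UL.GridVec H ε₀) (_ : v₀ ∈ UL.discUtil H L ε₀)
        -- an arbitrary rule to select a maximizing action
        (sel : ∀ i, (A i → ℝ) → A i) (_ : ∀ i (f : A i → ℝ) (a : A i), f a ≤ f (sel i f)),
        ENNReal.ofReal (1 - δ) ≤
          (UL.tractor M πE τE τ L ε₀ α K T sel v₀).toOuterMeasure
            {Uhat | ∀ U ∈ UL.incUtilLip H L, (∀ j : Fin (UL.gridCard H ε₀), U ((j : ℕ) * ε₀) = Uhat j) →
              U ∈ UL.relaxedFeasible M πE ε} := by
  -- Without covering arguments no extra logarithmic factor is needed, so that the exponent `0`,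
  -- the strongest choice, is possible.
  refine ⟨10 ^ 5, 0, by norm_num, ?_⟩
  intro N H hN hH S A _ _ M πE L ε δ _ hε hδ UE hUE hopt τE τ hτE hτ T hT K hK ε₀ hε₀ α hα v₀ hv₀
    sel hsel
  simp only [UL.softO, pow_zero, mul_one] at hτE hτ hK
  have hL := UL.one_le_of_mem_incUtilLip hH hUE
  have hN' : (1 : ℝ) ≤ N := by exact_mod_cast hN
  have hH' : (1 : ℝ) ≤ H := by exact_mod_cast hH
  have hε0 := hε.1
  have hε1 := hε.2
  have hδ0 := hδ.1
  have hε₀' : 0 < ε₀ := by rw [hε₀]; positivity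
  rcases lt_or_ge (H * N * L / (δ * ε)) (5 / 4) with hQ | hQ
  · rw [(PMF.toOuterMeasure_apply_eq_one_iff _ _).2 fun Uhat _ U hU _ => ⟨hU.1,
      (UL.sum_nonCompat_le_of_lipschitz M hUE hU hopt).trans
        (UL.degenerate_error_le hN hH hL hε hδ hQ)⟩]
    exact ENNReal.ofReal_le_one.2 (by linarith)
  have hT5 : (10 : ℝ) ^ 5 ≤ T := by
    refine le_trans (le_mul_of_one_le_right (by norm_num) ?_) hT
    rw [one_le_div (by positivity)]
    exact (pow_le_one₀ hε0.le hε1.le).trans (one_le_mul_of_one_le_of_one_le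
      (one_le_mul_of_one_le_of_one_le (one_le_pow₀ hN') (one_le_pow₀ hH')) (one_le_pow₀ hL))
  have hT0 : (0 : ℝ) < T := by linarith
  have hHε : (H : ℝ) / ε₀ = 80 * N ^ 2 * L ^ 2 * H ^ 2 / ε ^ 2 := by
    rw [hε₀]; field_simp
  have hm : (⌊(H : ℝ) / ε₀⌋₊ : ℝ) ≤ 80 * N ^ 2 * L ^ 2 * H ^ 2 / ε ^ 2 :=
    (Nat.floor_le (by positivity)).trans_eq hHε
  have hm3 : (3 : ℝ) ≤ ⌊(H : ℝ) / ε₀⌋₊ := by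
    have h3 : 3 ≤ ⌊(H : ℝ) / ε₀⌋₊ := by
      refine Nat.le_floor ?_
      rw [hHε, le_div_iff₀ (by positivity)]
      have h1 : (1 : ℝ) ≤ N ^ 2 * L ^ 2 * H ^ 2 := one_le_mul_of_one_le_of_one_le
        (one_le_mul_of_one_le_of_one_le (one_le_pow₀ hN') (one_le_pow₀ hL)) (one_le_pow₀ hH')
      have h2 : ε ^ 2 ≤ 1 := pow_le_one₀ hε0.le hε1.le
      push_cast
      linarith
    exact_mod_cast h3
  have hα0 : 0 < α := by
    have := Real.sqrt_pos.2 (show 0 < (⌊(H : ℝ) / ε₀⌋₊ : ℝ) - 1 by linarith)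
    rw [hα]; positivity
  have hS (i) : 1 ≤ Fintype.card (S i) := Fintype.card_pos_iff.2 ⟨(M i).s0⟩
  have hA (i) : 1 ≤ Fintype.card (A i) := Fintype.card_pos_iff.2 ⟨sel i 0⟩
  have hn (i) : 5 * 10 ^ 4 * ((N : ℝ) ^ 2 * H ^ 4 / ε ^ 2 * (Fintype.card (S i) +
      Real.log (Fintype.card (S i) * Fintype.card (A i) * H * N / δ))) ≤
      (UL.samplesPerTriple (S i) (A i) H (τ i) : ℕ) ∧
      0 < UL.samplesPerTriple (S i) (A i) H (τ i) := by
    have hS' : (1 : ℝ) ≤ Fintype.card (S i) := by exact_mod_cast hS i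
    have hA' : (1 : ℝ) ≤ Fintype.card (A i) := by exact_mod_cast hA i
    have hlog : 0 ≤ Real.log (Fintype.card (S i) * Fintype.card (A i) * H * N / δ) := by
      refine Real.log_nonneg ?_
      rw [one_le_div hδ0]
      exact hδ.2.le.trans (one_le_mul_of_one_le_of_one_le (one_le_mul_of_one_le_of_one_le
        (one_le_mul_of_one_le_of_one_le hS' hA') hH') hN')
    have hW : 1 ≤ 5 * 10 ^ 4 * ((N : ℝ) ^ 2 * H ^ 4 / ε ^ 2 * (Fintype.card (S i) +
        Real.log (Fintype.card (S i) * Fintype.card (A i) * H * N / δ))) := by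
      refine one_le_mul_of_one_le_of_one_le (by norm_num)
        (one_le_mul_of_one_le_of_one_le ?_ (by linarith))
      rw [one_le_div (by positivity)]
      exact (pow_le_one₀ hε0.le hε1.le).trans
        (one_le_mul_of_one_le_of_one_le (one_le_pow₀ hN') (one_le_pow₀ hH'))
    have h := UL.le_floor_div_of_le hW
      (Nat.mul_pos (Nat.mul_pos (hS i) (hA i)) hH) (by push_cast; rfl)
      (le_trans (le_of_eq (by ring)) (hτ i))
    exact ⟨h, by exact_mod_cast lt_of_lt_of_le one_pos (hW.trans h)⟩
  have hτE0 (i) : 0 < τE i := by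
    have := Real.log_pos (show 1 < H * N * L / (δ * ε) by linarith)
    have h := lt_of_lt_of_le (by positivity) (hτE i)
    exact_mod_cast h
  have hK0 : 0 < K := by
    have := Real.log_pos (show 1 < N * T / δ by
      rw [lt_div_iff₀ hδ0]
      nlinarith [hδ.2])
    have h := lt_of_lt_of_le (by positivity) hK
    exact_mod_cast h
  -- each of the three sources of randomness contributes an error `ε / (10 * N)` per environment and
  -- a failure probability `δ / 4`
  refine UL.ofReal_le_toOuterMeasure_tractor hH hε₀' (by linarith) M πE hUE hopt hτE0
    (fun i => (hn i).2) hK0 (by exact_mod_cast hT0) hα0 hv₀ hsel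
    (t₁ := ε / (10 * N * H ^ 2)) (t₂ := ε / (10 * N * H)) (t₃ := ε / (10 * N * H))
    (a := δ / (4 * N)) (b := δ / (4 * N)) (by positivity) (by positivity) (by positivity)
    (by positivity) (by positivity)
    (fun i => UL.expert_tail_le hN' hH' hL hε hδ hQ hm (hτE i))
    (fun i => UL.model_tail_le hN' hH' (hS i) (by exact_mod_cast hA i) hε hδ (hn i).1) ?_ ?_
  · have h1 := UL.rollout_tail_le hN' hH' hT5 hε hδ hK
    have h2 : (N : ℝ) * (δ / (4 * N)) = δ / 4 := by field_simp
    rw [h2]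
    linarith
  · have h1 := UL.optimization_error_le hN' hH' hL hε hT hm3 hm
      (UL.norm_sub_sq_le_of_mem_discUtil hε₀' hv₀ (UL.gridRestrict_mem_discUtil hUE)) hα
    rw [add_assoc _ (2 * α * (N : ℝ) ^ 2)]
    exact UL.total_error_le hN' hH' hL hε hε₀ h1
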